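/- **Theorem (total truncation error of the barycentric shifted Gegenbauer pseudospectral discretization of the integral diffusion equation).** *Setting.* Let $L,t_f>0$, $\alpha>-\tfrac12$, and let $N_y,N_t\ge 1$ be integers. Let $G^{(\alpha)}_0=1$, $G^{(\alpha)}_1=x$, $(n+2\alpha)G^{(\alpha)}_{n+1}=2(n+\alpha)xG^{(\alpha)}_n-nG^{(\alpha)}_{n-1}$ $(n\ge1)$ be the Gegenbauer polynomials, and $G^{(\alpha)}_{l,n}(x)=G^{(\alpha)}_n(2x/l-1)$ the shifted ones on $[0,l]$. Let $x_{l,n,0}<\dots<x_{l,n,n}$ be the zeros of $G^{(\alpha)}_{l,n+1}$ (the SGG nodes), let $\varpi_{l,n,i}$ be their Christoffel numbers for the weight $(x(l-x))^{\alpha-1/2}$ on $[0,l]$, and put $$\xi_{l,n,i}=2(-1)^i\sqrt{4^{\alpha}l^{-2(1+\alpha)}(l-x_{l,n,i})\,x_{l,n,i}\,\varpi_{l,n,i}},\qquad \mathcal L_{l,n,k}(x)=\frac{\xi_{l,n,k}}{x-x_{l,n,k}}\Big/\sum_{j=0}^n\frac{\xi_{l,n,j}}{x-x_{l,n,j}}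 .$$ The $q$-th order integration matrix ${}_lP^{(q)}_n$ has the entries $${}_lp^{(q)}_{n,i,k}=\frac{(x_{l,n,i}-x_{l,n,k})^{q-1}}{(q-1)!}\int_0^{x_{l,n,i}}\mathcal L_{l,n,k}(x)\,dx .$$ Write $y_i=x_{L,N_y,i}$ and $t_j=x_{t_f,N_t,j}$. Let $\phi,u$ be real functions on $[0,L]\times[0,t_f]$, let $f$ be a real function on $[0,L]$, and set $\psi(y,t)=\phi(0,t)-\phi(y,t)+u(0,t)-u(y,t)$. The integral diffusion equation $$\int_0^{y}\!\int_0^{\sigma_1}\phi(\sigma_0,t)\,d\sigma_0\,d\sigma_1+\int_0^{t}\psi(y,\sigma)\,d\sigma=f(y)-f(0)$$ is discretized at $(y_i,t_j)$ by $$\sum_{s=0}^{N_y}{}_Lp^{(2)}_{N_y,i,s}\,\phi(y_s,t_j)+\sum_{k=0}^{N_t}{}_{t_f}p^{(1)}_{N_t,j,k}\,\psi(y_i,t_k)=f(y_i)-f(0).$$ The total truncation error $E_{\mathrm{total},i,j}$ is the residual (left side minus right side) of the integral equation at $(y_i,t_j)$ minus the residual of the discrete equation. *Hypotheses.* Suppose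 that $\psi(y,\cdot)\in C^{N_t+1}[0,t_f]$ for every $y\in[0,L]$, and that the partial derivatives $\partial^k\phi/\partial y^k$, $0\le k\le N_y+1$, exist on $[0,L]\times[0,t_f]$ and satisfy there $|\partial^k\phi/\partial y^k|\le A_{\max}$ for some $A_{\max}>0$. *Conclusion.* There exist $\zeta^y_i\in(0,L)$, $0\le i\le N_y$, and $\zeta^t_j\in(0,t_f)$, $0\le j\le N_t$, such that for all positive numbers $B_{\max,j}$ with $$\sup_{0\le y\le L}\Big|\frac{\partial^{N_t+1}\psi}{\partial t^{N_t+1}}(y,\zeta^t_j)\Big|\le B_{\max,j},\qquad 0\le j\le N_t,$$ one has, for all $0\le i\le N_y$ and $0\le j\le N_t$, $$|E_{\mathrm{total},i,j}|\le D^{(\alpha)}(\varepsilon_{1,j}+\varepsilon_{2,i}),\qquad D^{(\alpha)}=\frac{\Gamma(1+\alpha)}{2\,\Gamma(1+2\alpha)},$$ where $$\varepsilon_{1,j}=\frac{4^{-N_t}B_{\max,j}\,t_f^{N_t+1}\,t_j}{(N_t+1)!\,\Gamma(N_t+\alpha+1)}\cdot\begin{cases}\Gamma(N_t+2\alpha+1),&\alpha\ge0,\\[4pt]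 \dfrac{-2\alpha\binom{N_t/2+\alpha}{N_t/2}(N_t+1)!\,|\Gamma(2\alpha)|}{\sqrt{(N_t+1)(N_t+2\alpha+1)}},&N_t\text{ even},\ -\tfrac12<\alpha<0,\\[10pt] \left|\binom{(N_t-1)/2+\alpha}{(N_t+1)/2}\right|(N_t+1)!\,|\Gamma(2\alpha)|,&N_t\text{ odd},\ -\tfrac12<\alpha<0,\end{cases}$$ $$\varepsilon_{2,i}=\frac{A_{\max}\,n_{\max,i}\,2^{1-N_y}\,y_i\,L^{N_y+1}\,\Gamma(N_y+2\alpha+1)}{(N_y+1)!\,\Gamma(1+N_y+\alpha)}\cdot\begin{cases}1,&\alpha\ge0,\\[4pt] \dfrac{2|\alpha|\left|\binom{N_y/2+\alpha}{N_y/2}\right|(N_y+1)!\,|\Gamma(2\alpha)|}{\sqrt{(N_y+1)(N_y+2\alpha+1)}\,\Gamma(N_y+2\alpha+1)},&N_y\text{ even},\ -\tfrac12<\alpha<0,\\[10pt] \dfrac{\left|\binom{(N_y-1)/2+\alpha}{(N_y+1)/2}\right|(N_y+1)!\,|\Gamma(2\alpha)|}{\Gamma(N_y+2\alpha+1)},&N_y\text{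 odd},\ -\tfrac12<\alpha<0,\end{cases}$$ and $n_{\max,i}=\max\{1,|y_i-\zeta^y_i|\}$. Here $\binom{r}{m}=r(r-1)\cdots(r-m+1)/m!$ for real $r$ and integers $m\ge0$. -/

import Mathlib

open Polynomial Set

noncomputable section

namespace BSGPM

/-- The Gegenbauer polynomials with parameter `α`, standardized by `G_n(1) = 1`:
`G_0 = 1`, `G_1 = X` and `(n + 2 α) G_{n+1} = 2 (n + α) X G_n - n G_{n-1}` for `n ≥ 1`.
For `α = 0` these are the Chebyshev polynomials of the first kind. -/
def gegenbauer (α : ℝ) : ℕ → ℝ[X]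
  | 0 => 1
  | 1 => X
  | n + 2 =>
      C (((n : ℝ) + 1 + 2 * α)⁻¹) *
        (C (2 * ((n : ℝ) + 1 + α)) * X * gegenbauer α (n + 1) -
          C ((n : ℝ) + 1) * gegenbauer α n)

/-- The shifted Gegenbauer polynomial `G_{l,n}(x) = G_n(2 x / l - 1)` on `[0, l]`. -/
def shiftedGegenbauer (l α : ℝ) (n : ℕ) : ℝ[X] :=
  (gegenbauer α n).comp (C (2 / l) * X - 1)

/-- The shifted Gegenbauer-Gauss nodes `x_{l,n,0} < ⋯ < x_{l,n,n}`: the zeros of `G_{l,n+1}`,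
sorted ascendingly. -/
def node (l α : ℝ) (n : ℕ) (i : Fin (n + 1)) : ℝ :=
  ((shiftedGegenbauer l α (n + 1)).roots.sort).getD i 0

/-- The Christoffel numbers: the weights of the interpolatory (Gauss) quadrature at the nodes
for the weight function `(x (l - x)) ^ (α - 1/2)` on `[0, l]`. -/
def christoffel (l α : ℝ) (n : ℕ) (i : Fin (n + 1)) : ℝ :=
  ∫ x in (0 : ℝ)..l, (x * (l - x)) ^ (α - 1 / 2) *
    (Lagrange.basis Finset.univ (node l α n) i).eval x

/-- The shifted barycentric weights `ξ_{l,n,i}`. -/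
def baryWeight (l α : ℝ) (n : ℕ) (i : Fin (n + 1)) : ℝ :=
  2 * (-1) ^ (i : ℕ) *
    Real.sqrt ((4 : ℝ) ^ α * l ^ (-2 * (1 + α)) * (l - node l α n i) * node l α n i *
      christoffel l α n i)

/-- The barycentric form of the `k`-th Lagrange interpolating polynomial at the nodes. The formula
is meaningful away from the finitely many nodes; below it only occurs under an integral. -/
def baryLagrange (l α : ℝ) (n : ℕ) (k : Fin (n + 1)) (x : ℝ) : ℝ :=
  baryWeight l α n k / (x - node l α n k) /
    ∑ j : Fin (n + 1), baryWeight l α n j / (x - node l α n j)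

/-- The first-order barycentric shifted Gegenbauer integration matrix: entry `(i, k)` is the
integral over `[0, x_i]` of the `k`-th Lagrange interpolating polynomial. -/
def integMatrixOne (l α : ℝ) (n : ℕ) (i k : Fin (n + 1)) : ℝ :=
  ∫ x in (0 : ℝ)..(node l α n i), baryLagrange l α n k x

/-- The `q`-th order barycentric shifted Gegenbauer integration matrix (`q ≥ 1`), with entries
`(x_i - x_k)^(q-1) / (q-1)!` times those of the first-order matrix. -/
def integMatrix (l α : ℝ) (n q : ℕ) (i k : Fin (n + 1)) : ℝ :=
  (node l α n i - node l α n k) ^ (q - 1) / ((q - 1).factorial : ℝ) * integMatrixOne l α n i k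

/-- The `q`-fold iterated integral from `0`. -/
def iterInt : ℕ → (ℝ → ℝ) → ℝ → ℝ
  | 0, g => g
  | q + 1, g => fun x => ∫ s in (0 : ℝ)..x, iterInt q g s

/-- `ψ(y,t) = φ(0,t) - φ(y,t) + u(0,t) - u(y,t)`. -/
def psi (φ u : ℝ → ℝ → ℝ) (y t : ℝ) : ℝ := φ 0 t - φ y t + u 0 t - u y t

/-- Left-hand side minus right-hand side, at `(y,t)`, of the integral diffusion equation
`I₂^{(y)} φ + I₁^{(t)} (φ(0,t) - φ(y,t) + u(0,t) - u(y,t)) = f(y) - f(0)`. -/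
def integralResidual (f : ℝ → ℝ) (φ u : ℝ → ℝ → ℝ) (y t : ℝ) : ℝ :=
  iterInt 2 (fun s => φ s t) y + iterInt 1 (fun s => psi φ u y s) t - (f y - f 0)

/-- Left-hand side minus right-hand side of the discrete integral diffusion equation at the
grid point `(y_i, t_j)`. -/
def discreteResidual (L tf α : ℝ) (Ny Nt : ℕ) (f : ℝ → ℝ) (φ u : ℝ → ℝ → ℝ)
    (i : Fin (Ny + 1)) (j : Fin (Nt + 1)) : ℝ :=
  ∑ s : Fin (Ny + 1), integMatrix L α Ny 2 i s * φ (node L α Ny s) (node tf α Nt j) +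
    ∑ k : Fin (Nt + 1), integMatrix tf α Nt 1 j k *
      psi φ u (node L α Ny i) (node tf α Nt k) -
    (f (node L α Ny i) - f 0)

/-- The total truncation error of the discretization at the grid point `(y_i, t_j)`. -/
def totalError (L tf α : ℝ) (Ny Nt : ℕ) (f : ℝ → ℝ) (φ u : ℝ → ℝ → ℝ)
    (i : Fin (Ny + 1)) (j : Fin (Nt + 1)) : ℝ :=
  integralResidual f φ u (node L α Ny i) (node tf α Nt j) -
    discreteResidual L tf α Ny Nt f φ u i j

/-- `D^{(α)} = Γ(1+α) / (2 Γ(1+2α))`. -/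
def constD (α : ℝ) : ℝ := Real.Gamma (1 + α) / (2 * Real.Gamma (1 + 2 * α))

/-- `ε_{1,j}`, as a function of the bound `B = B_{max,j}` and the node `t = t_j`. -/
def eps1 (α tf : ℝ) (N : ℕ) (B t : ℝ) : ℝ :=
  (4 : ℝ)⁻¹ ^ N * B * tf ^ (N + 1) * t /
      (((N + 1).factorial : ℝ) * Real.Gamma ((N : ℝ) + α + 1)) *
    (if 0 ≤ α then Real.Gamma ((N : ℝ) + 2 * α + 1)
     else if Even N then
      -(2 * α * Ring.choose ((N : ℝ) / 2 + α) (N / 2) * ((N + 1).factorial : ℝ) *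
          |Real.Gamma (2 * α)|) /
        Real.sqrt (((N : ℝ) + 1) * ((N : ℝ) + 2 * α + 1))
     else
      |Ring.choose (((N : ℝ) - 1) / 2 + α) ((N + 1) / 2)| * ((N + 1).factorial : ℝ) *
        |Real.Gamma (2 * α)|)

/-- `n_{max,i} = max {1, |y_i - ζ_i|}`, as a function of `y = y_i` and `ζ = ζ_i`. -/
def nMax (y ζ : ℝ) : ℝ := max 1 |y - ζ|

/-- `ε_{2,i}`, as a function of `A = A_max`, of `m = n_{max,i}` and of the node `y = y_i`. -/
def eps2 (α L : ℝ) (N : ℕ) (A m y : ℝ) : ℝ :=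
  A * m * (2 : ℝ) ^ (1 - (N : ℤ)) * y * L ^ (N + 1) * Real.Gamma ((N : ℝ) + 2 * α + 1) /
      (((N + 1).factorial : ℝ) * Real.Gamma (1 + (N : ℝ) + α)) *
    (if 0 ≤ α then 1
     else if Even N then
      2 * |α| * |Ring.choose ((N : ℝ) / 2 + α) (N / 2)| * ((N + 1).factorial : ℝ) *
          |Real.Gamma (2 * α)| /
        (Real.sqrt (((N : ℝ) + 1) * ((N : ℝ) + 2 * α + 1)) *
          Real.Gamma ((N : ℝ) + 2 * α + 1))
     else
      |Ring.choose (((N : ℝ) - 1) / 2 + α) ((N + 1) / 2)| * ((N + 1).factorial : ℝ) *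
          |Real.Gamma (2 * α)| /
        Real.Gamma ((N : ℝ) + 2 * α + 1))

end BSGPM

end

/-!
The error of interpolating `g` at the Gegenbauer nodes is `g⁽ᴺ⁺¹⁾(ζ) / (N + 1)!` times the monic
Gegenbauer polynomial, whose size on the interval is read off from the monotonicity of Sonin's
function. By the Christoffel–Darboux formula the barycentric weights are proportional to the
nodal weights of Lagrange interpolation, so the first-order integration matrix integrates the
interpolant exactly. By Cauchy's formula for the iterated integral, the second-order matrix at
`y_i` is the first-order matrix applied to `s ↦ (y_i - s) φ(s, t_j)`, whose `k`-th derivative is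
`(y_i - s) ∂ᵏφ - k ∂ᵏ⁻¹φ`. These arguments give points `ζ` depending on both `i` and `j`;
`ζ^t_j` is taken from the row with the largest error in time, and `ζ^y_i` from the column with
the largest `n_max`.
-/

namespace BSGPM

section Interpolation

variable {a b : ℝ}

theorem exists_finset_hasDerivAt_eq_zero {F F' : ℝ → ℝ} (hc : ContinuousOn F (Icc a b))
    (hd : ∀ x ∈ Ioo a b, HasDerivAt F (F' x) x) {m : ℕ} {t : Finset ℝ} (ht : t.card = m + 1)
    (hmem : ∀ x ∈ t, x ∈ Icc a b) (h0 : ∀ x ∈ t, F x = 0) :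
    ∃ u : Finset ℝ, u.card = m ∧ (∀ x ∈ u, x ∈ Ioo a b) ∧ ∀ x ∈ u, F' x = 0 := by
  set z := t.orderEmbOfFin ht
  have hz (i) : z i ∈ Icc a b := hmem _ (t.orderEmbOfFin_mem ht i)
  have hz0 (i) : F (z i) = 0 := h0 _ (t.orderEmbOfFin_mem ht i)
  have rolle (i : Fin m) : ∃ y ∈ Ioo (z i.castSucc) (z i.succ), F' y = 0 :=
    exists_hasDerivAt_eq_zero (z.strictMono Fin.castSucc_lt_succ)
      (hc.mono (Icc_subset_Icc (hz _).1 (hz _).2)) ((hz0 _).trans (hz0 _).symm)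
      fun x hx => hd x (Ioo_subset_Ioo (hz _).1 (hz _).2 hx)
  choose y hy hy0 using rolle
  have hymono : StrictMono y := fun i j hij => calc
    y i < z i.succ := (hy i).2
    _ ≤ z j.castSucc := z.monotone (Fin.succ_le_castSucc_iff.2 hij)
    _ < y j := (hy j).1
  refine ⟨Finset.univ.image y, ?_, ?_, ?_⟩
  · rw [Finset.card_image_of_injective _ hymono.injective, Finset.card_fin]
  · simpa using fun i => Ioo_subset_Ioo (hz i.castSucc).1 (hz i.succ).2 (hy i)
  · simpa using hy0

theorem exists_iterated_hasDerivAt_eq_zero {m : ℕ} {d : ℕ → ℝ → ℝ}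
    (hc : ∀ k ≤ m, ContinuousOn (d k) (Icc a b))
    (hd : ∀ k ≤ m, ∀ x ∈ Ioo a b, HasDerivAt (d k) (d (k + 1) x) x)
    {t : Finset ℝ} (ht : t.card = m + 2) (hmem : ∀ x ∈ t, x ∈ Icc a b)
    (h0 : ∀ x ∈ t, d 0 x = 0) : ∃ ζ ∈ Ioo a b, d (m + 1) ζ = 0 := by
  induction m generalizing d t with
  | zero =>
    obtain ⟨u, hu, humem, hu0⟩ :=
      exists_finset_hasDerivAt_eq_zero (hc 0 le_rfl) (hd 0 le_rfl) ht hmem h0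
    obtain ⟨ζ, hζ⟩ : u.Nonempty := Finset.card_pos.1 (by lia)
    exact ⟨ζ, humem ζ hζ, hu0 ζ hζ⟩
  | succ m ih =>
    obtain ⟨u, hu, humem, hu0⟩ :=
      exists_finset_hasDerivAt_eq_zero (hc 0 (by lia)) (hd 0 (by lia)) ht hmem h0
    exact ih (d := fun k => d (k + 1)) (fun k hk => hc _ (by lia)) (fun k hk => hd _ (by lia)) hu
      (fun x hx => Ioo_subset_Icc_self (humem x hx)) hu0

theorem hasDerivWithinAt_iteratedDerivWithin {f : ℝ → ℝ} {s : Set ℝ} {k : ℕ} {x : ℝ}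
    (hf : DifferentiableOn ℝ (iteratedDerivWithin k f s) s) (hx : x ∈ s) :
    HasDerivWithinAt (iteratedDerivWithin k f s) (iteratedDerivWithin (k + 1) f s x) s x := by
  rw [iteratedDerivWithin_succ]
  exact (hf x hx).hasDerivWithinAt

theorem exists_iteratedDerivWithin_eq_eval_iterate_derivative {f : ℝ → ℝ} {n : ℕ}
    (hf : ∀ k ≤ n, DifferentiableOn ℝ (iteratedDerivWithin k f (Icc a b)) (Icc a b))
    {p : ℝ[X]} {t : Finset ℝ} (ht : t.card = n + 2) (htmem : ∀ x ∈ t, x ∈ Icc a b)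
    (hp : ∀ x ∈ t, f x = p.eval x) :
    ∃ ζ ∈ Ioo a b,
      iteratedDerivWithin (n + 1) f (Icc a b) ζ = (derivative^[n + 1] p).eval ζ := by
  have hpd (k : ℕ) (x : ℝ) :
      HasDerivAt (fun s => (derivative^[k] p).eval s) ((derivative^[k + 1] p).eval x) x := by
    rw [Function.iterate_succ_apply']
    exact Polynomial.hasDerivAt _ _
  have hfd (k : ℕ) (hk : k ≤ n) (x : ℝ) (hx : x ∈ Icc a b) :=
    hasDerivWithinAt_iteratedDerivWithin (hf k hk) hx
  obtain ⟨ζ, hζ, h⟩ := exists_iterated_hasDerivAt_eq_zero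
    (d := fun k s => iteratedDerivWithin k f (Icc a b) s - (derivative^[k] p).eval s)
    (fun k hk x hx => (hfd k hk x hx).continuousWithinAt.sub
      (hpd k x).continuousAt.continuousWithinAt)
    (fun k hk x hx => ((hfd k hk x (Ioo_subset_Icc_self hx)).hasDerivAt
      (Icc_mem_nhds hx.1 hx.2)).sub (hpd k x))
    ht htmem (fun x hx => by simp [hp x hx])
  exact ⟨ζ, hζ, sub_eq_zero.1 h⟩

variable {ι : Type*} {s : Finset ι} {v : ι → ℝ}

theorem iterate_derivative_add_C_mul_nodal {p : ℝ[X]} (hp : p.degree < s.card) (c : ℝ) :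
    derivative^[s.card] (p + C c * Lagrange.nodal s v) = C (s.card.factorial * c) := by
  have hdeg : (p + C c * Lagrange.nodal s v).natDegree ≤ s.card :=
    natDegree_add_le_of_degree_le (natDegree_le_of_degree_le hp.le)
      ((natDegree_C_mul_le _ _).trans_eq Lagrange.natDegree_nodal)
  have hcoeff : (p + C c * Lagrange.nodal s v).coeff s.card = c := by
    have hmonic : (Lagrange.nodal s v).coeff s.card = 1 := by
      simpa only [Monic, leadingCoeff, Lagrange.natDegree_nodal] using
        Lagrange.nodal_monic (s := s) (v := v)
    rw [coeff_add, coeff_eq_zero_of_degree_lt hp, coeff_C_mul, hmonic, zero_add, mul_one]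
  rw [eq_C_of_natDegree_le_zero ((natDegree_iterate_derivative _ _).trans (by lia)),
    coeff_iterate_derivative, zero_add, hcoeff, Nat.descFactorial_self, nsmul_eq_mul]

variable [DecidableEq ι]

theorem exists_sub_eval_interpolate_eq {f : ℝ → ℝ}
    (hf : ∀ k < s.card, DifferentiableOn ℝ (iteratedDerivWithin k f (Icc a b)) (Icc a b))
    (hs : s.Nonempty) (hv : InjOn v s) (hvmem : ∀ i ∈ s, v i ∈ Icc a b) (hab : a < b)
    {x : ℝ} (hx : x ∈ Icc a b) :
    ∃ ζ ∈ Ioo a b, f x - (Lagrange.interpolate s v (f ∘ v)).eval x =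
      iteratedDerivWithin s.card f (Icc a b) ζ / s.card.factorial *
        (Lagrange.nodal s v).eval x := by
  set p := Lagrange.interpolate s v (f ∘ v)
  set w := Lagrange.nodal s v
  have hpv (i) (hi : i ∈ s) : p.eval (v i) = f (v i) := Lagrange.eval_interpolate_at_node _ hv hi
  by_cases hxv : ∃ i ∈ s, x = v i
  · obtain ⟨i, hi, rfl⟩ := hxv
    obtain ⟨ζ, hζ⟩ := nonempty_Ioo.2 hab
    exact ⟨ζ, hζ, by rw [hpv i hi, sub_self, Lagrange.eval_nodal_at_node hi, mul_zero]⟩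
  push Not at hxv
  have hwx : w.eval x ≠ 0 := Lagrange.eval_nodal_not_at_node hxv
  -- The multiple of the nodal polynomial that makes the interpolant also match `f` at `x`.
  set c := (f x - p.eval x) / w.eval x with hc
  obtain ⟨n, hn⟩ : ∃ n, s.card = n + 1 := Nat.exists_eq_succ_of_ne_zero hs.card_pos.ne'
  have hcard : (insert x (s.image v)).card = n + 2 := by
    rw [Finset.card_insert_of_notMem (by simpa using fun i hi => (hxv i hi).symm),
      Finset.card_image_of_injOn hv, hn]
  have hagree : ∀ y ∈ insert x (s.image v), y ∈ Icc a b ∧ f y = (p + C c * w).eval y := by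
    simp only [Finset.forall_mem_insert, Finset.forall_mem_image, eval_add, eval_mul, eval_C]
    refine ⟨⟨hx, by rw [hc, div_mul_cancel₀ _ hwx]; ring⟩, fun i hi => ⟨hvmem i hi, ?_⟩⟩
    rw [hpv i hi, Lagrange.eval_nodal_at_node hi, mul_zero, add_zero]
  obtain ⟨ζ, hζ, h⟩ := exists_iteratedDerivWithin_eq_eval_iterate_derivative
    (fun k hk => hf k (by lia)) hcard (fun y hy => (hagree y hy).1) (fun y hy => (hagree y hy).2)
  refine ⟨ζ, hζ, ?_⟩
  rw [← hn, iterate_derivative_add_C_mul_nodal (Lagrange.degree_interpolate_lt _ hv), eval_C] at h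
  rw [h, mul_div_cancel_left₀ _ (by positivity), hc, div_mul_cancel₀ _ hwx]

theorem sum_integral_basis_mul (r : ι → ℝ) :
    ∑ i ∈ s, (∫ x in a..b, (Lagrange.basis s v i).eval x) * r i =
      ∫ x in a..b, (Lagrange.interpolate s v r).eval x := by
  simp only [Lagrange.interpolate_apply, eval_finsetSum, eval_mul, eval_C]
  rw [intervalIntegral.integral_finsetSum]
  · simp only [intervalIntegral.integral_const_mul, mul_comm]
  · exact fun i _ => (continuous_const.mul (Polynomial.continuous _)).intervalIntegrable _ _

theorem exists_abs_integral_sub_sum_le {f : ℝ → ℝ}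
    (hf : ∀ k < s.card, DifferentiableOn ℝ (iteratedDerivWithin k f (Icc a b)) (Icc a b))
    (hs : s.Nonempty) (hv : InjOn v s) (hvmem : ∀ i ∈ s, v i ∈ Icc a b) (hab : a < b)
    {M : ℝ} (hM : ∀ x ∈ Icc a b, |(Lagrange.nodal s v).eval x| ≤ M) {τ : ℝ} (hτ : τ ∈ Icc a b) :
    ∃ ζ ∈ Ioo a b,
      |(∫ x in a..τ, f x) - ∑ i ∈ s, (∫ x in a..τ, (Lagrange.basis s v i).eval x) * f (v i)| ≤
        |iteratedDerivWithin s.card f (Icc a b) ζ| / s.card.factorial * M * (τ - a) := by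
  set p := Lagrange.interpolate s v (f ∘ v) with hp
  have hfc : ContinuousOn f (Icc a τ) := by
    have h0 := (hf 0 hs.card_pos).continuousOn
    rw [iteratedDerivWithin_zero] at h0
    exact h0.mono (Icc_subset_Icc_right hτ.2)
  obtain ⟨x, hx, hmax⟩ := isCompact_Icc.exists_isMaxOn (nonempty_Icc.2 hτ.1)
    (hfc.sub p.continuous.continuousOn).abs
  have hx' : x ∈ Icc a b := Icc_subset_Icc_right hτ.2 hx
  obtain ⟨ζ, hζ, herr⟩ := exists_sub_eval_interpolate_eq hf hs hv hvmem hab hx'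
  refine ⟨ζ, hζ, ?_⟩
  have hint : (∫ x in a..τ, f x) -
        ∑ i ∈ s, (∫ x in a..τ, (Lagrange.basis s v i).eval x) * f (v i) =
      ∫ x in a..τ, (f x - p.eval x) := by
    rw [intervalIntegral.integral_sub (hfc.intervalIntegrable_of_Icc hτ.1)
      (p.continuous.intervalIntegrable _ _), hp, ← sum_integral_basis_mul]
    rfl
  calc _ = ‖∫ x in a..τ, (f x - p.eval x)‖ := by rw [hint, Real.norm_eq_abs]
    _ ≤ |f x - p.eval x| * |τ - a| :=
      intervalIntegral.norm_integral_le_of_norm_le_const fun y hy =>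
        hmax (Ioc_subset_Icc_self (by rwa [uIoc_of_le hτ.1] at hy))
    _ = |iteratedDerivWithin s.card f (Icc a b) ζ| / s.card.factorial *
          |(Lagrange.nodal s v).eval x| * (τ - a) := by
      rw [hp, herr, abs_mul, abs_div, Nat.abs_cast, abs_of_nonneg (sub_nonneg.2 hτ.1)]
    _ ≤ _ := by
      gcongr
      · exact sub_nonneg.2 hτ.1
      · exact hM x hx'

end Interpolation

section Binomial

theorem succ_mul_choose_succ_succ (r : ℝ) (m : ℕ) :
    ((m : ℝ) + 1) * Ring.choose (r + 1) (m + 1) = (r + 1) * Ring.choose r m := by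
  simpa [nsmul_eq_mul, Ring.choose_one_right] using Ring.choose_add_smul_choose r m 1

theorem add_mul_choose_add_sub_one (r : ℝ) (m : ℕ) :
    (r + m) * Ring.choose (r + m - 1) m = r * Ring.choose (r + m) m := by
  have h₁ := succ_mul_choose_succ_succ (r + m - 1) m
  have h₂ := Ring.choose_add_smul_choose r 1 m
  rw [sub_add_cancel] at h₁
  rw [add_comm 1 m, Nat.choose_succ_self_right, nsmul_eq_mul, Ring.choose_one_right] at h₂
  push_cast at h₂
  rw [← h₁, h₂, mul_comm]

theorem choose_add_natCast_pos {r : ℝ} (hr : -1 < r) (m : ℕ) : 0 < Ring.choose (r + m) m := by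
  induction m with
  | zero => simp
  | succ m ih =>
    have := m.cast_nonneg (α := ℝ)
    have h := succ_mul_choose_succ_succ (r + m) m
    rw [add_assoc, ← Nat.cast_succ] at h
    exact pos_of_mul_pos_right (h ▸ mul_pos (by push_cast; linarith) ih) (Nat.cast_nonneg _)

end Binomial

section Gegenbauer

variable {α : ℝ}

theorem natCast_add_one_add_two_mul_pos (hα : -1 / 2 < α) (n : ℕ) : 0 < (n : ℝ) + 1 + 2 * α := by
  have := n.cast_nonneg (α := ℝ)
  linarith

theorem natCast_add_one_add_two_mul_C_ne_zero (hα : -1 / 2 < α) (n : ℕ) :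
    (n : ℝ[X]) + 1 + 2 * C α ≠ 0 := by
  have h : (n : ℝ[X]) + 1 + 2 * C α = C ((n : ℝ) + 1 + 2 * α) := by simp [C_ofNat]
  rw [h]
  exact C_ne_zero.2 (natCast_add_one_add_two_mul_pos hα n).ne'

theorem gegenbauer_succ_succ (hα : -1 / 2 < α) (n : ℕ) :
    ((n : ℝ[X]) + 1 + 2 * C α) * gegenbauer α (n + 2) =
      2 * ((n : ℝ[X]) + 1 + C α) * X * gegenbauer α (n + 1) -
        ((n : ℝ[X]) + 1) * gegenbauer α n := by
  have h : (n : ℝ[X]) + 1 + 2 * C α = C ((n : ℝ) + 1 + 2 * α) := by simp [C_ofNat]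
  rw [gegenbauer, h, ← mul_assoc, ← C_mul,
    mul_inv_cancel₀ (natCast_add_one_add_two_mul_pos hα n).ne']
  simp [C_ofNat]

/-- The two relations are proved together, as each feeds the induction step of the other. -/
theorem one_sub_sq_mul_derivative_gegenbauer_and_succ (hα : -1 / 2 < α) (n : ℕ) :
    (1 - X ^ 2) * derivative (gegenbauer α n) =
        ((n : ℝ[X]) + 2 * C α) * (X * gegenbauer α n - gegenbauer α (n + 1)) ∧
      (1 - X ^ 2) * derivative (gegenbauer α (n + 1)) =
        ((n : ℝ[X]) + 1) * (gegenbauer α n - X * gegenbauer α (n + 1)) := by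
  induction n with
  | zero => simp [gegenbauer, pow_two]
  | succ n ih =>
    obtain ⟨h₁, h₂⟩ := ih
    have hrec := gegenbauer_succ_succ hα n
    have hrec' := congrArg derivative hrec
    simp only [derivative_mul, derivative_add, derivative_sub, derivative_natCast,
      derivative_one, derivative_C, derivative_X, derivative_ofNat] at hrec'
    push_cast
    refine ⟨by linear_combination h₂ + hrec,
      mul_left_cancel₀ (natCast_add_one_add_two_mul_C_ne_zero hα n) ?_⟩
    linear_combination (1 - X ^ 2) * hrec' - ((n : ℝ[X]) + 1) * h₁ +
      2 * ((n : ℝ[X]) + 1 + C α) * X * h₂ + ((n : ℝ[X]) + 2) * X * hrec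

theorem one_sub_sq_mul_derivative_gegenbauer (hα : -1 / 2 < α) (n : ℕ) :
    (1 - X ^ 2) * derivative (gegenbauer α n) =
      ((n : ℝ[X]) + 2 * C α) * (X * gegenbauer α n - gegenbauer α (n + 1)) :=
  (one_sub_sq_mul_derivative_gegenbauer_and_succ hα n).1

theorem one_sub_sq_mul_derivative_gegenbauer_succ (hα : -1 / 2 < α) (n : ℕ) :
    (1 - X ^ 2) * derivative (gegenbauer α (n + 1)) =
      ((n : ℝ[X]) + 1) * (gegenbauer α n - X * gegenbauer α (n + 1)) :=
  (one_sub_sq_mul_derivative_gegenbauer_and_succ hα n).2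

theorem gegenbauer_ode (hα : -1 / 2 < α) (n : ℕ) :
    (1 - X ^ 2) * derivative (derivative (gegenbauer α n)) =
      (2 * C α + 1) * X * derivative (gegenbauer α n) -
        (n : ℝ[X]) * ((n : ℝ[X]) + 2 * C α) * gegenbauer α n := by
  have hX : (1 - X ^ 2 : ℝ[X]) ≠ 0 := fun h => by simpa using congrArg (eval 0) h
  have h₁ := one_sub_sq_mul_derivative_gegenbauer hα n
  have h₂ := one_sub_sq_mul_derivative_gegenbauer_succ hα n
  have hd := congrArg derivative h₁
  simp only [derivative_mul, derivative_add, derivative_sub, derivative_natCast, derivative_one,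
    derivative_C, derivative_X, derivative_X_pow, derivative_ofNat, Nat.cast_ofNat, map_ofNat]
    at hd
  refine mul_left_cancel₀ hX ?_
  linear_combination (1 - X ^ 2) * hd - ((n : ℝ[X]) + 2 * C α) * h₂ + ((n : ℝ[X]) + 1) * X * h₁

theorem eval_one_gegenbauer (hα : -1 / 2 < α) (n : ℕ) : (gegenbauer α n).eval 1 = 1 := by
  induction n with
  | zero => simp [gegenbauer]
  | succ n ih =>
    have hn : (n : ℝ) + 1 ≠ 0 := by positivity
    have h := congrArg (eval 1) (one_sub_sq_mul_derivative_gegenbauer_succ hα n)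
    have h' : 1 - (gegenbauer α (n + 1)).eval 1 = 0 := by simpa [ih, hn] using h
    linarith

theorem eval_neg_gegenbauer (α : ℝ) (n : ℕ) (x : ℝ) :
    (gegenbauer α n).eval (-x) = (-1) ^ n * (gegenbauer α n).eval x := by
  induction n using Nat.twoStepInduction with
  | zero => simp [gegenbauer]
  | one => simp [gegenbauer]
  | more n ih₁ ih₂ =>
    simp only [gegenbauer, eval_mul, eval_sub, eval_C, eval_X, ih₁, ih₂]
    ring

theorem abs_eval_abs_gegenbauer (α : ℝ) (n : ℕ) (x : ℝ) :
    |(gegenbauer α n).eval (|x|)| = |(gegenbauer α n).eval x| := by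
  rcases abs_choice x with h | h <;> rw [h]
  rw [eval_neg_gegenbauer, abs_mul, abs_neg_one_pow, one_mul]

theorem eval_zero_gegenbauer_odd (α : ℝ) {n : ℕ} (hn : Odd n) : (gegenbauer α n).eval 0 = 0 := by
  have h := eval_neg_gegenbauer α n 0
  rw [hn.neg_one_pow, neg_zero] at h
  linarith

theorem eval_zero_gegenbauer_succ_succ (hα : -1 / 2 < α) (n : ℕ) :
    ((n : ℝ) + 1 + 2 * α) * (gegenbauer α (n + 2)).eval 0 =
      -(((n : ℝ) + 1) * (gegenbauer α n).eval 0) := by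
  simpa using congrArg (eval 0) (gegenbauer_succ_succ hα n)

theorem natDegree_gegenbauer_le (α : ℝ) (n : ℕ) : (gegenbauer α n).natDegree ≤ n := by
  induction n using Nat.twoStepInduction with
  | zero => simp [gegenbauer]
  | one => simp [gegenbauer]
  | more n ih₁ ih₂ =>
    rw [gegenbauer, mul_assoc]
    have h₁ := natDegree_C_mul_le ((n : ℝ) + 1) (gegenbauer α n)
    have h₂ := natDegree_C_mul_le (2 * ((n : ℝ) + 1 + α)) (X * gegenbauer α (n + 1))
    have h₃ : (X * gegenbauer α (n + 1)).natDegree ≤ 1 + (n + 1) :=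
      natDegree_mul_le_of_le natDegree_X_le ih₂
    exact (natDegree_C_mul_le _ _).trans ((natDegree_sub_le _ _).trans (max_le (by lia) (by lia)))

theorem coeff_gegenbauer_succ_succ (hα : -1 / 2 < α) (n : ℕ) :
    ((n : ℝ) + 1 + 2 * α) * (gegenbauer α (n + 2)).coeff (n + 2) =
      2 * ((n : ℝ) + 1 + α) * (gegenbauer α (n + 1)).coeff (n + 1) := by
  have h : (gegenbauer α n).coeff (n + 2) = 0 :=
    coeff_eq_zero_of_natDegree_lt ((natDegree_gegenbauer_le α n).trans_lt (by lia))
  rw [gegenbauer, coeff_C_mul, mul_inv_cancel_left₀ (natCast_add_one_add_two_mul_pos hα n).ne',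
    coeff_sub, mul_assoc, coeff_C_mul, coeff_C_mul, coeff_X_mul, h, mul_zero, sub_zero]

theorem coeff_gegenbauer_succ_mul_Gamma (hα : -1 / 2 < α) (n : ℕ) :
    (gegenbauer α (n + 1)).coeff (n + 1) *
        (Real.Gamma (1 + α) * Real.Gamma (n + 1 + 2 * α)) =
      2 ^ n * Real.Gamma (n + 1 + α) * Real.Gamma (1 + 2 * α) := by
  induction n with
  | zero => simp [gegenbauer]
  | succ n ih =>
    have := n.cast_nonneg (α := ℝ)
    have hrec := coeff_gegenbauer_succ_succ hα n
    have h₁ : Real.Gamma ((n + 1 : ℕ) + 1 + 2 * α) =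
        (n + 1 + 2 * α) * Real.Gamma (n + 1 + 2 * α) := by
      rw [← Real.Gamma_add_one (natCast_add_one_add_two_mul_pos hα n).ne']
      push_cast
      ring_nf
    have h₂ : Real.Gamma ((n + 1 : ℕ) + 1 + α) = (n + 1 + α) * Real.Gamma (n + 1 + α) := by
      rw [← Real.Gamma_add_one (by linarith)]
      push_cast
      ring_nf
    rw [h₁, h₂]
    linear_combination Real.Gamma (1 + α) * Real.Gamma (n + 1 + 2 * α) * hrec +
      2 * ((n : ℝ) + 1 + α) * ih

theorem coeff_gegenbauer_succ_pos (hα : -1 / 2 < α) (n : ℕ) :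
    0 < (gegenbauer α (n + 1)).coeff (n + 1) := by
  induction n with
  | zero => simp [gegenbauer]
  | succ n ih =>
    have := n.cast_nonneg (α := ℝ)
    refine pos_of_mul_pos_right ?_ (natCast_add_one_add_two_mul_pos hα n).le
    rw [coeff_gegenbauer_succ_succ hα]
    exact mul_pos (by linarith) ih

theorem natDegree_gegenbauer_succ (hα : -1 / 2 < α) (n : ℕ) :
    (gegenbauer α (n + 1)).natDegree = n + 1 :=
  natDegree_eq_of_le_of_coeff_ne_zero (natDegree_gegenbauer_le α _)
    (coeff_gegenbauer_succ_pos hα n).ne'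

theorem leadingCoeff_gegenbauer_succ (hα : -1 / 2 < α) (n : ℕ) :
    (gegenbauer α (n + 1)).leadingCoeff = (gegenbauer α (n + 1)).coeff (n + 1) := by
  rw [leadingCoeff, natDegree_gegenbauer_succ hα]

theorem hasDerivAt_rpow_mul_eval_gegenbauer (hα : -1 / 2 < α) (n : ℕ) {x : ℝ}
    (hx : 0 < 1 - x ^ 2) :
    HasDerivAt (fun x => (1 - x ^ 2) ^ ((n + 2 * α) / 2) * (gegenbauer α n).eval x)
      (-(n + 2 * α) * (1 - x ^ 2) ^ ((n + 2 * α) / 2 - 1) * (gegenbauer α (n + 1)).eval x) x := by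
  set p := (n + 2 * α) / 2 with hp
  have hq : HasDerivAt (fun x : ℝ => 1 - x ^ 2) (-(2 * x)) x := by
    simpa using (hasDerivAt_pow 2 x).const_sub 1
  refine ((hq.rpow_const (p := p) (Or.inl hx.ne')).mul
    ((gegenbauer α n).hasDerivAt x)).congr_deriv ?_
  have hG := congrArg (eval x) (one_sub_sq_mul_derivative_gegenbauer hα n)
  simp only [eval_mul, eval_sub, eval_add, eval_pow, eval_one, eval_X, eval_C, eval_natCast,
    eval_ofNat] at hG
  have hpow : (1 - x ^ 2) ^ p = (1 - x ^ 2) ^ (p - 1) * (1 - x ^ 2) := by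
    rw [← Real.rpow_add_one hx.ne', sub_add_cancel]
  rw [hpow]
  linear_combination (1 - x ^ 2) ^ (p - 1) * hG -
    2 * x * (1 - x ^ 2) ^ (p - 1) * (gegenbauer α n).eval x * hp

theorem exists_gegenbauer_zeros (hα : -1 / 2 < α) (n : ℕ) :
    ∃ t : Finset ℝ, t.card = n + 1 ∧ (∀ x ∈ t, x ∈ Ioo (-1) 1) ∧
      ∀ x ∈ t, (gegenbauer α (n + 1)).eval x = 0 := by
  induction n with
  | zero => exact ⟨{0}, by simp [gegenbauer]⟩
  | succ n ih =>
    -- Rolle's theorem for `(1 - x²)^p G_{n+1}`, which has the additional zeros `±1`.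
    obtain ⟨t, ht, htmem, ht0⟩ := ih
    set p : ℝ := ((n + 1 : ℕ) + 2 * α) / 2 with hp
    have hp0 : 0 < p := by
      have := natCast_add_one_add_two_mul_pos hα n
      rw [hp]
      push_cast
      positivity
    have hsq {x : ℝ} (hx : x ∈ Ioo (-1) 1) : 0 < 1 - x ^ 2 := by nlinarith [hx.1, hx.2]
    have hcard : (insert (-1) (insert 1 t)).card = n + 1 + 1 + 1 := by
      have h₁ : (1 : ℝ) ∉ t := fun h => (htmem _ h).2.false
      have h₂ : (-1 : ℝ) ∉ insert 1 t := by
        rw [Finset.mem_insert, not_or]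
        exact ⟨by norm_num, fun h => (htmem _ h).1.false⟩
      rw [Finset.card_insert_of_notMem h₂, Finset.card_insert_of_notMem h₁, ht]
    obtain ⟨u, hu, humem, hu0⟩ := exists_finset_hasDerivAt_eq_zero (a := -1) (b := 1)
      (Continuous.continuousOn <| (Continuous.rpow_const (by fun_prop) fun _ => Or.inr hp0.le).mul
        (gegenbauer α (n + 1)).continuous)
      (fun x hx => hasDerivAt_rpow_mul_eval_gegenbauer hα (n + 1) (hsq hx)) hcard
      (by simpa using fun x hx => Ioo_subset_Icc_self (htmem x hx))
      (by simpa [Real.zero_rpow hp0.ne'] using fun x hx => Or.inr (ht0 x hx))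
    refine ⟨u, hu, humem, fun x hx => (mul_eq_zero.1 (hu0 x hx)).resolve_left ?_⟩
    exact mul_ne_zero (by linarith) (Real.rpow_pos_of_pos (hsq (humem x hx)) _).ne'

/-- Sonin's function of the Gegenbauer differential equation: it dominates a multiple of `G_n²` on
`[-1, 1]`, and its derivative has the sign of `α x`. -/
noncomputable def sonin (α : ℝ) (n : ℕ) : ℝ[X] :=
  (n : ℝ[X]) * ((n : ℝ[X]) + 2 * C α) * gegenbauer α n ^ 2 +
    (1 - X ^ 2) * derivative (gegenbauer α n) ^ 2

theorem eval_sonin (α : ℝ) (n : ℕ) (x : ℝ) :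
    (sonin α n).eval x = (n : ℝ) * (n + 2 * α) * (gegenbauer α n).eval x ^ 2 +
      (1 - x ^ 2) * (derivative (gegenbauer α n)).eval x ^ 2 := by
  simp [sonin]

theorem eval_derivative_sonin (hα : -1 / 2 < α) (n : ℕ) (x : ℝ) :
    (derivative (sonin α n)).eval x =
      4 * α * x * (derivative (gegenbauer α n)).eval x ^ 2 := by
  have h : derivative (sonin α n) = 4 * C α * X * derivative (gegenbauer α n) ^ 2 := by
    simp only [sonin, derivative_mul, derivative_add, derivative_sub, derivative_natCast,
      derivative_one, derivative_C, derivative_X, derivative_ofNat, derivative_pow,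
      Nat.cast_ofNat, map_ofNat]
    linear_combination 2 * derivative (gegenbauer α n) * gegenbauer_ode hα n
  simp [h]

theorem monotoneOn_eval_sonin (hα : 0 ≤ α) (n : ℕ) :
    MonotoneOn (fun x => (sonin α n).eval x) (Ici 0) := by
  refine monotoneOn_of_deriv_nonneg (convex_Ici 0) (Polynomial.continuousOn _)
    (Polynomial.differentiableOn _) fun x hx => ?_
  rw [interior_Ici, mem_Ioi] at hx
  rw [Polynomial.deriv, eval_derivative_sonin (by linarith)]
  positivity

theorem antitoneOn_eval_sonin (hα : -1 / 2 < α) (hα0 : α ≤ 0) (n : ℕ) :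
    AntitoneOn (fun x => (sonin α n).eval x) (Ici 0) := by
  refine antitoneOn_of_deriv_nonpos (convex_Ici 0) (Polynomial.continuousOn _)
    (Polynomial.differentiableOn _) fun x hx => ?_
  rw [interior_Ici, mem_Ioi] at hx
  rw [Polynomial.deriv, eval_derivative_sonin hα]
  exact mul_nonpos_of_nonpos_of_nonneg (mul_nonpos_of_nonpos_of_nonneg (by linarith) hx.le)
    (sq_nonneg _)

theorem mul_sq_eval_gegenbauer_le_eval_sonin (α : ℝ) (n : ℕ) {x : ℝ} (hx : |x| ≤ 1) :
    (n : ℝ) * (n + 2 * α) * (gegenbauer α n).eval x ^ 2 ≤ (sonin α n).eval x := by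
  have hx' : 0 ≤ 1 - x ^ 2 := sub_nonneg.2 ((sq_le_one_iff_abs_le_one x).2 hx)
  rw [eval_sonin, le_add_iff_nonneg_right]
  positivity

theorem abs_eval_gegenbauer_le_one (hα : 0 ≤ α) (n : ℕ) {x : ℝ} (hx : |x| ≤ 1) :
    |(gegenbauer α (n + 1)).eval x| ≤ 1 := by
  rw [← abs_eval_abs_gegenbauer, ← sq_le_one_iff_abs_le_one]
  have h := (mul_sq_eval_gegenbauer_le_eval_sonin α (n + 1) (by rwa [abs_abs])).trans
    (monotoneOn_eval_sonin hα (n + 1) (abs_nonneg x) (mem_Ici.2 zero_le_one) hx)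
  simp only [eval_sonin, eval_one_gegenbauer (show -1 / 2 < α by linarith), one_pow, sub_self,
    zero_mul, add_zero] at h
  exact le_of_mul_le_mul_left h (by positivity)

theorem mul_sq_eval_gegenbauer_succ_le (hα : -1 / 2 < α) (hα0 : α ≤ 0) (n : ℕ) {x : ℝ}
    (hx : |x| ≤ 1) :
    ((n : ℝ) + 1) * (n + 1 + 2 * α) * (gegenbauer α (n + 1)).eval x ^ 2 ≤
      ((n : ℝ) + 1) * (n + 1 + 2 * α) * (gegenbauer α (n + 1)).eval 0 ^ 2 +
        (((n : ℝ) + 1) * (gegenbauer α n).eval 0) ^ 2 := by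
  have hderiv : (derivative (gegenbauer α (n + 1))).eval 0 =
      ((n : ℝ) + 1) * (gegenbauer α n).eval 0 := by
    simpa using congrArg (eval 0) (one_sub_sq_mul_derivative_gegenbauer_succ hα n)
  have h := (mul_sq_eval_gegenbauer_le_eval_sonin α (n + 1) (by rwa [abs_abs])).trans
    (antitoneOn_eval_sonin hα hα0 (n + 1) self_mem_Ici (abs_nonneg x) (abs_nonneg x))
  simp only [← sq_abs (eval |x| _), abs_eval_abs_gegenbauer, eval_sonin, hderiv] at h
  rw [sq_abs] at h
  push_cast at h
  linarith

theorem mul_sqrt_abs_eval_gegenbauer_odd_le (hα : -1 / 2 < α) (hα0 : α ≤ 0) (m : ℕ) {x : ℝ}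
    (hx : |x| ≤ 1) :
    |(gegenbauer α (2 * m + 1)).eval x| * √((2 * m + 1) * (2 * m + 1 + 2 * α)) ≤
      (2 * m + 1) * |(gegenbauer α (2 * m)).eval 0| := by
  have hpos : (0 : ℝ) ≤ 2 * m + 1 + 2 * α := by linarith [m.cast_nonneg (α := ℝ)]
  have h := mul_sq_eval_gegenbauer_succ_le hα hα0 (2 * m) hx
  rw [eval_zero_gegenbauer_odd α (odd_two_mul_add_one m)] at h
  refine le_of_sq_le_sq ?_ (by positivity)
  rw [mul_pow, Real.sq_sqrt (by positivity), sq_abs, mul_pow, sq_abs]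
  push_cast at h
  linarith

theorem abs_eval_gegenbauer_even_le (hα : -1 / 2 < α) (hα0 : α ≤ 0) (m : ℕ) {x : ℝ}
    (hx : |x| ≤ 1) :
    |(gegenbauer α (2 * m + 2)).eval x| ≤ |(gegenbauer α (2 * m + 2)).eval 0| := by
  have hpos := natCast_add_one_add_two_mul_pos hα (2 * m + 1)
  have h := mul_sq_eval_gegenbauer_succ_le hα hα0 (2 * m + 1) hx
  rw [eval_zero_gegenbauer_odd α (odd_two_mul_add_one m), mul_zero, zero_pow two_ne_zero,
    add_zero] at h
  exact sq_le_sq.1 (le_of_mul_le_mul_left h (by positivity))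

theorem two_mul_natCast_add_ne_zero (hα : -1 / 2 < α) (hα0 : α ≠ 0) (m : ℕ) :
    2 * (m : ℝ) + 2 * α ≠ 0 := by
  rcases m.eq_zero_or_pos with rfl | hm
  · simpa using hα0
  · have : (1 : ℝ) ≤ m := by exact_mod_cast hm
    exact (by linarith : 0 < 2 * (m : ℝ) + 2 * α).ne'

theorem abs_eval_zero_gegenbauer_even_mul_Gamma (hα : -1 / 2 < α) (hα0 : α ≠ 0) (m : ℕ) :
    |(gegenbauer α (2 * m)).eval 0| * |Real.Gamma (2 * m + 2 * α)| =
      |Ring.choose (α + m - 1) m| * (2 * m).factorial * |Real.Gamma (2 * α)| := by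
  induction m with
  | zero => simp [gegenbauer]
  | succ m ih =>
    have := m.cast_nonneg (α := ℝ)
    have hG := congrArg abs (eval_zero_gegenbauer_succ_succ hα (2 * m))
    have hchoose := congrArg abs (succ_mul_choose_succ_succ (α + m - 1) m)
    have hΓ : |Real.Gamma (2 * (m + 1 : ℕ) + 2 * α)| =
        (2 * m + 1 + 2 * α) * (2 * |α + m|) * |Real.Gamma (2 * m + 2 * α)| := by
      have hne := two_mul_natCast_add_ne_zero hα hα0 m
      rw [show 2 * ((m + 1 : ℕ) : ℝ) + 2 * α = 2 * m + 2 * α + 1 + 1 by push_cast; ring,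
        Real.Gamma_add_one (by linarith), Real.Gamma_add_one hne, abs_mul, abs_mul,
        abs_of_pos (by linarith : (0 : ℝ) < 2 * m + 2 * α + 1),
        show 2 * (m : ℝ) + 2 * α = 2 * (α + m) by ring, abs_mul 2, abs_two]
      ring
    rw [abs_neg, abs_mul, abs_mul, abs_of_pos (natCast_add_one_add_two_mul_pos hα (2 * m)),
      abs_of_pos (by positivity : (0 : ℝ) < (2 * m : ℕ) + 1)] at hG
    rw [sub_add_cancel, abs_mul, abs_mul, abs_of_pos (by positivity : (0 : ℝ) < m + 1)] at hchoose
    push_cast at hG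
    rw [hΓ, show α + (m + 1 : ℕ) - 1 = α + m by push_cast; ring, mul_add_one, Nat.factorial_succ,
      Nat.factorial_succ]
    push_cast
    linear_combination 2 * |α + m| * |Real.Gamma (2 * m + 2 * α)| * hG +
      (2 * m + 1) * (2 * |α + m|) * ih -
      2 * (2 * m + 1) * (2 * m).factorial * |Real.Gamma (2 * α)| * hchoose

theorem two_mul_add_one_mul_abs_eval_zero_gegenbauer_mul_Gamma (hα : -1 / 2 < α) (hα0 : α ≠ 0)
    (m : ℕ) :
    (2 * m + 1) * |(gegenbauer α (2 * m)).eval 0| * |Real.Gamma (2 * m + 1 + 2 * α)| =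
      2 * |α| * Ring.choose (α + m) m * (2 * m + 1).factorial * |Real.Gamma (2 * α)| := by
  have hne := two_mul_natCast_add_ne_zero hα hα0 m
  have hG := abs_eval_zero_gegenbauer_even_mul_Gamma hα hα0 m
  have hchoose := congrArg abs (add_mul_choose_add_sub_one α m)
  rw [abs_mul, abs_mul, abs_of_pos (choose_add_natCast_pos (by linarith) m)] at hchoose
  rw [show 2 * (m : ℝ) + 1 + 2 * α = 2 * m + 2 * α + 1 by ring, Real.Gamma_add_one hne, abs_mul,
    show 2 * (m : ℝ) + 2 * α = 2 * (α + m) by ring, abs_mul 2, abs_two,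
    show 2 * (α + (m : ℝ)) = 2 * m + 2 * α by ring, Nat.factorial_succ]
  push_cast
  linear_combination (2 * m + 1) * (2 * |α + m|) * hG +
    2 * (2 * m + 1) * (2 * m).factorial * |Real.Gamma (2 * α)| * hchoose

/-- The factor of `ε_{1,j}` given by a case distinction: a bound of `Γ(N + 2α + 1) |G_{N+1}|` on
`[-1, 1]`. -/
noncomputable def gegenbauerBound (α : ℝ) (N : ℕ) : ℝ :=
  if 0 ≤ α then Real.Gamma ((N : ℝ) + 2 * α + 1)
  else if Even N then
    -(2 * α * Ring.choose ((N : ℝ) / 2 + α) (N / 2) * ((N + 1).factorial : ℝ) *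
        |Real.Gamma (2 * α)|) /
      √(((N : ℝ) + 1) * ((N : ℝ) + 2 * α + 1))
  else
    |Ring.choose (((N : ℝ) - 1) / 2 + α) ((N + 1) / 2)| * ((N + 1).factorial : ℝ) *
      |Real.Gamma (2 * α)|

theorem gegenbauerBound_two_mul (hα : α < 0) (m : ℕ) :
    gegenbauerBound α (2 * m) = 2 * |α| * Ring.choose (α + m) m * (2 * m + 1).factorial *
      |Real.Gamma (2 * α)| / √((2 * m + 1) * (2 * m + 1 + 2 * α)) := by
  have hm : ((2 * m : ℕ) : ℝ) / 2 + α = α + m := by push_cast; ring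
  rw [gegenbauerBound, if_neg hα.not_ge, if_pos (even_two_mul m), hm,
    Nat.mul_div_cancel_left m two_pos, abs_of_neg hα]
  push_cast
  ring_nf

theorem gegenbauerBound_two_mul_add_one (hα : α < 0) (m : ℕ) :
    gegenbauerBound α (2 * m + 1) =
      |Ring.choose (α + (m + 1 : ℕ) - 1) (m + 1)| * (2 * (m + 1)).factorial *
        |Real.Gamma (2 * α)| := by
  have hm : (((2 * m + 1 : ℕ) : ℝ) - 1) / 2 + α = α + (m + 1 : ℕ) - 1 := by push_cast; ring
  rw [gegenbauerBound, if_neg hα.not_ge, if_neg (Nat.not_even_two_mul_add_one m), hm,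
    show 2 * m + 1 + 1 = 2 * (m + 1) by ring, Nat.mul_div_cancel_left _ two_pos]

theorem abs_eval_gegenbauer_mul_Gamma_le (hα : -1 / 2 < α) (N : ℕ) {x : ℝ} (hx : |x| ≤ 1) :
    |(gegenbauer α (N + 1)).eval x| * Real.Gamma (N + 1 + 2 * α) ≤ gegenbauerBound α N := by
  have hpos := natCast_add_one_add_two_mul_pos hα N
  have hΓ := Real.Gamma_pos_of_pos hpos
  rcases le_or_gt 0 α with hα0 | hα0
  · rw [gegenbauerBound, if_pos hα0, add_right_comm (N : ℝ) (2 * α)]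
    exact mul_le_of_le_one_left hΓ.le (abs_eval_gegenbauer_le_one hα0 N hx)
  obtain ⟨m, rfl | rfl⟩ := N.even_or_odd'
  · push_cast at hpos
    rw [gegenbauerBound_two_mul hα0, le_div_iff₀ (Real.sqrt_pos.2 (by positivity)),
      ← two_mul_add_one_mul_abs_eval_zero_gegenbauer_mul_Gamma hα hα0.ne, mul_right_comm,
      ← abs_of_pos hΓ]
    push_cast
    exact mul_le_mul_of_nonneg_right (mul_sqrt_abs_eval_gegenbauer_odd_le hα hα0.le m hx)
      (abs_nonneg _)
  · rw [gegenbauerBound_two_mul_add_one hα0, ← abs_eval_zero_gegenbauer_even_mul_Gamma hα hα0.ne,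
      show 2 * ((m + 1 : ℕ) : ℝ) = (2 * m + 1 : ℕ) + 1 by push_cast; ring, abs_of_pos hΓ]
    exact mul_le_mul_of_nonneg_right (abs_eval_gegenbauer_even_le hα hα0.le m hx) hΓ.le

end Gegenbauer

section Nodes

variable {l α : ℝ}

theorem eval_shiftedGegenbauer (l α : ℝ) (n : ℕ) (x : ℝ) :
    (shiftedGegenbauer l α n).eval x = (gegenbauer α n).eval (2 / l * x - 1) := by
  simp [shiftedGegenbauer]

theorem derivative_shiftedGegenbauer (l α : ℝ) (n : ℕ) :
    derivative (shiftedGegenbauer l α n) =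
      C (2 / l) * (derivative (gegenbauer α n)).comp (C (2 / l) * X - 1) := by
  simp [shiftedGegenbauer, derivative_comp]

theorem shiftedGegenbauer_succ_succ (l α : ℝ) (n : ℕ) :
    shiftedGegenbauer l α (n + 2) = C (((n : ℝ) + 1 + 2 * α)⁻¹) *
      (C (2 * ((n : ℝ) + 1 + α)) * (C (2 / l) * X - 1) * shiftedGegenbauer l α (n + 1) -
        C ((n : ℝ) + 1) * shiftedGegenbauer l α n) := by
  simp only [shiftedGegenbauer, gegenbauer, mul_comp, sub_comp, C_comp, X_comp]

theorem mul_sub_mul_two_div_sq (hl : l ≠ 0) (x : ℝ) :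
    x * (l - x) * (2 / l) ^ 2 = 1 - (2 / l * x - 1) ^ 2 := by
  field_simp
  ring

theorem natDegree_C_mul_X_sub_one {c : ℝ} (hc : c ≠ 0) : (C c * X - 1 : ℝ[X]).natDegree = 1 := by
  rw [← C_1, natDegree_sub_C, natDegree_C_mul_X c hc]

theorem natDegree_shiftedGegenbauer_succ (hl : 0 < l) (hα : -1 / 2 < α) (n : ℕ) :
    (shiftedGegenbauer l α (n + 1)).natDegree = n + 1 := by
  rw [shiftedGegenbauer, natDegree_comp, natDegree_gegenbauer_succ hα,
    natDegree_C_mul_X_sub_one (by positivity), mul_one]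

theorem leadingCoeff_shiftedGegenbauer_succ (hl : 0 < l) (hα : -1 / 2 < α) (n : ℕ) :
    (shiftedGegenbauer l α (n + 1)).leadingCoeff =
      (gegenbauer α (n + 1)).coeff (n + 1) * (2 / l) ^ (n + 1) := by
  have hdeg : (C (2 / l) * X - 1 : ℝ[X]).natDegree = 1 :=
    natDegree_C_mul_X_sub_one (by positivity)
  have hlead : (C (2 / l) * X - 1 : ℝ[X]).leadingCoeff = 2 / l := by
    simp [leadingCoeff, hdeg, coeff_one]
  rw [shiftedGegenbauer, leadingCoeff_comp (by rw [hdeg]; exact one_ne_zero), hlead,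
    leadingCoeff_gegenbauer_succ hα, natDegree_gegenbauer_succ hα]

theorem leadingCoeff_shiftedGegenbauer_succ_pos (hl : 0 < l) (hα : -1 / 2 < α) (n : ℕ) :
    0 < (shiftedGegenbauer l α (n + 1)).leadingCoeff := by
  rw [leadingCoeff_shiftedGegenbauer_succ hl hα]
  exact mul_pos (coeff_gegenbauer_succ_pos hα n) (by positivity)

theorem exists_roots_shiftedGegenbauer_eq (hl : 0 < l) (hα : -1 / 2 < α) (n : ℕ) :
    ∃ t : Finset ℝ, t.card = n + 1 ∧ (∀ x ∈ t, x ∈ Ioo 0 l) ∧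
      (shiftedGegenbauer l α (n + 1)).roots = t.val := by
  obtain ⟨t, ht, htmem, ht0⟩ := exists_gegenbauer_zeros hα n
  have hinj : Function.Injective fun r : ℝ => (r + 1) * (l / 2) := fun r s h =>
    add_right_cancel (mul_right_cancel₀ (by positivity) h)
  have hcard : (t.image fun r => (r + 1) * (l / 2)).card = n + 1 := by
    rw [Finset.card_image_of_injective _ hinj, ht]
  have h0 (r : ℝ) (hr : r ∈ t) :
      (shiftedGegenbauer l α (n + 1)).eval ((r + 1) * (l / 2)) = 0 := by
    rw [eval_shiftedGegenbauer, ← ht0 r hr]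
    congr 1
    field_simp
    ring
  refine ⟨t.image fun r => (r + 1) * (l / 2), hcard, ?_,
    roots_eq_of_natDegree_le_card_of_ne_zero (by simpa using h0) ?_ ?_⟩
  · refine Finset.forall_mem_image.2 fun r hr => ?_
    have := htmem r hr
    constructor <;> nlinarith [this.1, this.2]
  · rw [natDegree_shiftedGegenbauer_succ hl hα, hcard]
  · exact leadingCoeff_ne_zero.1 (leadingCoeff_shiftedGegenbauer_succ_pos hl hα n).ne'

theorem node_eq_orderEmbOfFin {n : ℕ} {t : Finset ℝ} (ht : t.card = n + 1)
    (hroots : (shiftedGegenbauer l α (n + 1)).roots = t.val) :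
    node l α n = t.orderEmbOfFin ht := by
  funext i
  rw [Finset.orderEmbOfFin_apply, node, hroots, List.getD_eq_getElem]
  rfl

theorem node_strictMono (hl : 0 < l) (hα : -1 / 2 < α) (n : ℕ) : StrictMono (node l α n) := by
  obtain ⟨t, ht, -, hroots⟩ := exists_roots_shiftedGegenbauer_eq hl hα n
  rw [node_eq_orderEmbOfFin ht hroots]
  exact (t.orderEmbOfFin ht).strictMono

theorem node_mem_Ioo (hl : 0 < l) (hα : -1 / 2 < α) (n : ℕ) (i : Fin (n + 1)) :
    node l α n i ∈ Ioo 0 l := by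
  obtain ⟨t, ht, htmem, hroots⟩ := exists_roots_shiftedGegenbauer_eq hl hα n
  rw [node_eq_orderEmbOfFin ht hroots]
  exact htmem _ (t.orderEmbOfFin_mem ht i)

theorem shiftedGegenbauer_succ_eq_C_mul_nodal (hl : 0 < l) (hα : -1 / 2 < α) (n : ℕ) :
    shiftedGegenbauer l α (n + 1) = C (shiftedGegenbauer l α (n + 1)).leadingCoeff *
      Lagrange.nodal Finset.univ (node l α n) := by
  obtain ⟨t, ht, -, hroots⟩ := exists_roots_shiftedGegenbauer_eq hl hα n
  have hprod := C_leadingCoeff_mul_prod_multiset_X_sub_C (p := shiftedGegenbauer l α (n + 1))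
    (by rw [hroots, natDegree_shiftedGegenbauer_succ hl hα, Finset.card_val, ht])
  have hnodal : Lagrange.nodal Finset.univ (node l α n) = ∏ x ∈ t, (X - C x) := by
    have hmap := Finset.prod_map Finset.univ (t.orderEmbOfFin ht).toEmbedding fun x => X - C x
    rw [Finset.map_orderEmbOfFin_univ] at hmap
    rw [node_eq_orderEmbOfFin ht hroots, hmap]
    rfl
  rw [hnodal]
  rw [hroots] at hprod
  exact hprod.symm

theorem eval_node_shiftedGegenbauer_succ (hl : 0 < l) (hα : -1 / 2 < α) (n : ℕ)
    (i : Fin (n + 1)) : (shiftedGegenbauer l α (n + 1)).eval (node l α n i) = 0 := by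
  rw [shiftedGegenbauer_succ_eq_C_mul_nodal hl hα, eval_mul,
    Lagrange.eval_nodal_at_node (Finset.mem_univ i), mul_zero]

end Nodes

section WeightIntegral

variable {l α : ℝ}

/-- The linear functional on polynomials given by integration against the Gegenbauer weight
`(x (l - x)) ^ (α - 1/2)` on `[0, l]`. -/
noncomputable def weightIntegral (l α : ℝ) (q : ℝ[X]) : ℝ :=
  ∫ x in (0 : ℝ)..l, (x * (l - x)) ^ (α - 1 / 2) * q.eval x

theorem intervalIntegrable_weight (hl : 0 < l) (hα : -1 / 2 < α) :
    IntervalIntegrable (fun x : ℝ => (x * (l - x)) ^ (α - 1 / 2)) MeasureTheory.volume 0 l := by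
  have hleft : IntervalIntegrable (fun x : ℝ => (x * (l - x)) ^ (α - 1 / 2))
      MeasureTheory.volume 0 (l / 2) := by
    have hpow : IntervalIntegrable (fun x : ℝ => x ^ (α - 1 / 2)) MeasureTheory.volume 0 (l / 2) :=
      intervalIntegral.intervalIntegrable_rpow' (by linarith)
    have hcont : ContinuousOn (fun x : ℝ => (l - x) ^ (α - 1 / 2)) (uIcc 0 (l / 2)) := by
      rw [uIcc_of_le (by positivity)]
      exact ContinuousOn.rpow_const (by fun_prop) fun x hx => Or.inl (by linarith [hx.2])
    refine (hpow.mul_continuousOn hcont).congr fun x hx => ?_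
    rw [uIoc_of_le (by positivity)] at hx
    exact (Real.mul_rpow hx.1.le (by linarith [hx.2])).symm
  have hright := (hleft.comp_sub_left l).symm
  rw [sub_zero, sub_half] at hright
  refine hleft.trans (hright.congr fun x _ => ?_)
  rw [sub_sub_cancel, mul_comm]

theorem intervalIntegrable_weight_mul_eval (hl : 0 < l) (hα : -1 / 2 < α) (q : ℝ[X]) :
    IntervalIntegrable (fun x : ℝ => (x * (l - x)) ^ (α - 1 / 2) * q.eval x)
      MeasureTheory.volume 0 l :=
  (intervalIntegrable_weight hl hα).mul_continuousOn q.continuous.continuousOn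

theorem weightIntegral_C_mul (l α a : ℝ) (q : ℝ[X]) :
    weightIntegral l α (C a * q) = a * weightIntegral l α q := by
  simp only [weightIntegral, eval_mul, eval_C, mul_left_comm _ a,
    intervalIntegral.integral_const_mul]

theorem weightIntegral_add (hl : 0 < l) (hα : -1 / 2 < α) (p q : ℝ[X]) :
    weightIntegral l α (p + q) = weightIntegral l α p + weightIntegral l α q := by
  simp only [weightIntegral, eval_add, mul_add]
  exact intervalIntegral.integral_add (intervalIntegrable_weight_mul_eval hl hα p)
    (intervalIntegrable_weight_mul_eval hl hα q)

theorem weightIntegral_one_pos (hl : 0 < l) (hα : -1 / 2 < α) : 0 < weightIntegral l α 1 := by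
  refine intervalIntegral.intervalIntegral_pos_of_pos_on
    (intervalIntegrable_weight_mul_eval hl hα 1) (fun x hx => ?_) hl
  rw [eval_one, mul_one]
  exact Real.rpow_pos_of_pos (mul_pos hx.1 (sub_pos.2 hx.2)) _

theorem shiftedGegenbauer_ode (hl : l ≠ 0) (hα : -1 / 2 < α) (n : ℕ) (x : ℝ) :
    x * (l - x) * (derivative (derivative (shiftedGegenbauer l α n))).eval x +
        (α + 1 / 2) * (l - 2 * x) * (derivative (shiftedGegenbauer l α n)).eval x =
      -(n * (n + 2 * α)) * (shiftedGegenbauer l α n).eval x := by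
  have hode := congrArg (eval (2 / l * x - 1)) (gegenbauer_ode hα n)
  have hsq := mul_sub_mul_two_div_sq hl x
  have hlin : (l - 2 * x) * (2 / l) = -2 * (2 / l * x - 1) := by
    field_simp
    ring
  simp only [derivative_shiftedGegenbauer, derivative_C_mul, derivative_comp,
    eval_shiftedGegenbauer, eval_mul, eval_sub, eval_one, eval_pow, eval_X, eval_add, eval_C,
    eval_natCast, eval_ofNat, eval_comp, derivative_sub, derivative_X, derivative_one, sub_zero,
    mul_one] at hode ⊢
  linear_combination hode +
    (derivative (derivative (gegenbauer α n))).eval (2 / l * x - 1) * hsq +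
    (α + 1 / 2) * (derivative (gegenbauer α n)).eval (2 / l * x - 1) * hlin

theorem hasDerivAt_weight_mul_eval_derivative_shiftedGegenbauer (hα : -1 / 2 < α) (n : ℕ) {x : ℝ}
    (hx : x ∈ Ioo 0 l) :
    HasDerivAt
      (fun x => (x * (l - x)) ^ (α + 1 / 2) * (derivative (shiftedGegenbauer l α n)).eval x)
      ((x * (l - x)) ^ (α - 1 / 2) *
        (C (-(n * (n + 2 * α))) * shiftedGegenbauer l α n).eval x) x := by
  have hw : 0 < x * (l - x) := mul_pos hx.1 (sub_pos.2 hx.2)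
  have hd : HasDerivAt (fun x : ℝ => x * (l - x)) (1 * (l - x) + x * (-1)) x :=
    (hasDerivAt_id x).mul ((hasDerivAt_id x).const_sub l)
  have hpow : (x * (l - x)) ^ (α + 1 / 2) = (x * (l - x)) ^ (α - 1 / 2) * (x * (l - x)) := by
    rw [← Real.rpow_add_one hw.ne']
    ring_nf
  refine ((hd.rpow_const (p := α + 1 / 2) (Or.inl hw.ne')).mul
    ((derivative (shiftedGegenbauer l α n)).hasDerivAt x)).congr_deriv ?_
  rw [hpow, show α + 1 / 2 - 1 = α - 1 / 2 by ring, eval_mul, eval_C,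
    ← shiftedGegenbauer_ode (hx.1.trans hx.2).ne' hα]
  ring

theorem weightIntegral_shiftedGegenbauer_succ (hl : 0 < l) (hα : -1 / 2 < α) (n : ℕ) :
    weightIntegral l α (shiftedGegenbauer l α (n + 1)) = 0 := by
  set P := shiftedGegenbauer l α (n + 1)
  set c : ℝ := (n + 1 : ℕ) * ((n + 1 : ℕ) + 2 * α) with hc
  have hc0 : c ≠ 0 := by
    have := natCast_add_one_add_two_mul_pos hα n
    rw [hc]
    push_cast
    positivity
  have hcont : Continuous fun x : ℝ => (x * (l - x)) ^ (α + 1 / 2) * (derivative P).eval x :=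
    (Continuous.rpow_const (by fun_prop) fun _ => Or.inr (by linarith)).mul
      (derivative P).continuous
  have h : weightIntegral l α (C (-c) * P) = 0 := by
    rw [weightIntegral,
      intervalIntegral.integral_eq_sub_of_hasDerivAt_of_le hl.le hcont.continuousOn
      (fun x hx => hasDerivAt_weight_mul_eval_derivative_shiftedGegenbauer hα (n + 1) hx)
      (intervalIntegrable_weight_mul_eval hl hα _)]
    rw [sub_self, mul_zero, zero_mul, Real.zero_rpow (by linarith), zero_mul, zero_mul, sub_zero]
  rw [weightIntegral_C_mul] at h
  exact (mul_eq_zero.1 h).resolve_left (neg_ne_zero.2 hc0)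

end WeightIntegral

section ChristoffelDarboux

variable {l α : ℝ}

/-- The Christoffel–Darboux kernel of the shifted Gegenbauer polynomials as a polynomial in its
first variable, the second variable being `y`. It is scaled so that `(X - y) K_n` is
`G_{l,n}(y) G_{l,n+1} - G_{l,n+1}(y) G_{l,n}`. -/
noncomputable def christoffelDarbouxKernel (l α y : ℝ) : ℕ → ℝ[X]
  | 0 => C (2 / l)
  | n + 1 =>
      C (((n : ℝ) + 1 + 2 * α)⁻¹) *
        (C (2 * ((n : ℝ) + 1 + α) * (2 / l) * (shiftedGegenbauer l α (n + 1)).eval y) *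
            shiftedGegenbauer l α (n + 1) +
          C ((n : ℝ) + 1) * christoffelDarbouxKernel l α y n)

theorem X_sub_C_mul_christoffelDarbouxKernel (l α y : ℝ) (n : ℕ) :
    (X - C y) * christoffelDarbouxKernel l α y n =
      C ((shiftedGegenbauer l α n).eval y) * shiftedGegenbauer l α (n + 1) -
        C ((shiftedGegenbauer l α (n + 1)).eval y) * shiftedGegenbauer l α n := by
  induction n with
  | zero =>
    simp only [christoffelDarbouxKernel, shiftedGegenbauer, gegenbauer, X_comp, one_comp, eval_one,
      eval_sub, eval_mul, eval_X, eval_C, map_one, map_sub, map_mul]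
    ring
  | succ n ih =>
    rw [christoffelDarbouxKernel, shiftedGegenbauer_succ_succ]
    simp only [eval_mul, eval_C, eval_sub, eval_X, eval_one, map_mul, map_sub, map_one]
    linear_combination C (((n : ℝ) + 1 + 2 * α)⁻¹) * C ((n : ℝ) + 1) * ih

theorem exists_weightIntegral_christoffelDarbouxKernel (hl : 0 < l) (hα : -1 / 2 < α) (n : ℕ) :
    ∃ c > 0, ∀ y, weightIntegral l α (christoffelDarbouxKernel l α y n) = c := by
  induction n with
  | zero =>
    refine ⟨2 / l * weightIntegral l α 1,
      mul_pos (by positivity) (weightIntegral_one_pos hl hα), fun y => ?_⟩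
    rw [← weightIntegral_C_mul, mul_one, christoffelDarbouxKernel]
  | succ n ih =>
    obtain ⟨c, hc, ih⟩ := ih
    have := natCast_add_one_add_two_mul_pos hα n
    refine ⟨((n : ℝ) + 1 + 2 * α)⁻¹ * (((n : ℝ) + 1) * c), by positivity, fun y => ?_⟩
    rw [christoffelDarbouxKernel, weightIntegral_C_mul, weightIntegral_add hl hα,
      weightIntegral_C_mul, weightIntegral_C_mul, ih, weightIntegral_shiftedGegenbauer_succ hl hα,
      mul_zero, zero_add]

theorem eval_derivative_shiftedGegenbauer_succ_node (hl : 0 < l) (hα : -1 / 2 < α) (n : ℕ)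
    (i : Fin (n + 1)) :
    2 / l * (node l α n i * (l - node l α n i)) *
        (derivative (shiftedGegenbauer l α (n + 1))).eval (node l α n i) =
      (n + 1) * (shiftedGegenbauer l α n).eval (node l α n i) := by
  have hroot := eval_node_shiftedGegenbauer_succ hl hα n i
  rw [eval_shiftedGegenbauer] at hroot
  set x := node l α n i
  have h := congrArg (eval (2 / l * x - 1)) (one_sub_sq_mul_derivative_gegenbauer_succ hα n)
  simp only [eval_mul, eval_sub, eval_one, eval_pow, eval_X, eval_add, eval_natCast, hroot,
    ← mul_sub_mul_two_div_sq hl.ne' x, mul_zero, sub_zero] at h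
  rw [derivative_shiftedGegenbauer, eval_shiftedGegenbauer, ← h, eval_mul, eval_C, eval_comp]
  simp only [eval_sub, eval_mul, eval_C, eval_X, eval_one]
  ring

theorem eval_derivative_shiftedGegenbauer_succ_node_mul_nodalWeight (hl : 0 < l)
    (hα : -1 / 2 < α) (n : ℕ) (i : Fin (n + 1)) :
    (derivative (shiftedGegenbauer l α (n + 1))).eval (node l α n i) *
        Lagrange.nodalWeight Finset.univ (node l α n) i =
      (shiftedGegenbauer l α (n + 1)).leadingCoeff := by
  have hW := Lagrange.nodalWeight_ne_zero (node_strictMono hl hα n).injective.injOn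
    (Finset.mem_univ i)
  rw [Lagrange.nodalWeight_eq_eval_derivative_nodal (Finset.mem_univ i)] at hW ⊢
  conv_lhs => rw [shiftedGegenbauer_succ_eq_C_mul_nodal hl hα]
  rw [derivative_C_mul, eval_mul, eval_C, mul_assoc, mul_inv_cancel₀ (inv_eq_zero.not.1 hW),
    mul_one]

theorem eval_shiftedGegenbauer_node_mul_basis (hl : 0 < l) (hα : -1 / 2 < α) (n : ℕ)
    (i : Fin (n + 1)) :
    C ((shiftedGegenbauer l α n).eval (node l α n i) *
          (shiftedGegenbauer l α (n + 1)).leadingCoeff) *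
        Lagrange.basis Finset.univ (node l α n) i =
      C (Lagrange.nodalWeight Finset.univ (node l α n) i) *
        christoffelDarbouxKernel l α (node l α n i) n := by
  set x := node l α n i
  have hi := Finset.mem_univ i
  have hnodal : Lagrange.nodal Finset.univ (node l α n) =
      (X - C x) * Lagrange.nodal (Finset.univ.erase i) (node l α n) :=
    Lagrange.nodal_eq_mul_nodal_erase hi
  refine mul_left_cancel₀ (X_sub_C_ne_zero x) ?_
  rw [mul_left_comm _ (C (Lagrange.nodalWeight _ _ _)), X_sub_C_mul_christoffelDarbouxKernel,
    eval_node_shiftedGegenbauer_succ hl hα, C_0, zero_mul, sub_zero,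
    Lagrange.basis_eq_prod_sub_inv_mul_nodal_div hi, ← Lagrange.nodal_erase_eq_nodal_div hi]
  conv_rhs => rw [shiftedGegenbauer_succ_eq_C_mul_nodal hl hα, hnodal]
  rw [C_mul, Lagrange.nodalWeight]
  ring

theorem exists_node_mul_sub_mul_christoffel_eq (hl : 0 < l) (hα : -1 / 2 < α) (n : ℕ) :
    ∃ c > 0, ∀ i, node l α n i * (l - node l α n i) * christoffel l α n i =
      c * Lagrange.nodalWeight Finset.univ (node l α n) i ^ 2 := by
  obtain ⟨c, hc, hkernel⟩ := exists_weightIntegral_christoffelDarbouxKernel hl hα n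
  have hκ := leadingCoeff_shiftedGegenbauer_succ_pos hl hα n
  set κ := (shiftedGegenbauer l α (n + 1)).leadingCoeff
  refine ⟨((n : ℝ) + 1) * c * l / (2 * κ ^ 2), by positivity, fun i => ?_⟩
  set x := node l α n i
  set p := (shiftedGegenbauer l α n).eval x
  set W := Lagrange.nodalWeight Finset.univ (node l α n) i
  have hbasis : p * κ * christoffel l α n i = W * c := by
    rw [← hkernel x, ← weightIntegral_C_mul, ← eval_shiftedGegenbauer_node_mul_basis hl hα,
      weightIntegral_C_mul]
    rfl
  have hp : 2 / l * (x * (l - x)) * κ = (n + 1) * p * W := by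
    have h₁ := eval_derivative_shiftedGegenbauer_succ_node hl hα n i
    have h₂ := eval_derivative_shiftedGegenbauer_succ_node_mul_nodalWeight hl hα n i
    linear_combination W * h₁ - 2 / l * (x * (l - x)) * h₂
  have h : 2 / l * κ ^ 2 * (x * (l - x) * christoffel l α n i) = (n + 1) * c * W ^ 2 := by
    linear_combination κ * christoffel l α n i * hp + ((n : ℝ) + 1) * W * hbasis
  field_simp at h ⊢
  linear_combination h

end ChristoffelDarboux

section Barycentric

theorem neg_one_pow_mul_abs_nodalWeight {n : ℕ} {v : Fin (n + 1) → ℝ} (hv : StrictMono v)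
    (i : Fin (n + 1)) :
    (-1) ^ (i : ℕ) * |Lagrange.nodalWeight Finset.univ v i| =
      (-1) ^ n * Lagrange.nodalWeight Finset.univ v i := by
  have habs : ∏ j ∈ Finset.univ.erase i, |(v i - v j)⁻¹| =
      ∏ j ∈ Finset.univ.erase i, (if i < j then -1 else 1) * (v i - v j)⁻¹ := by
    refine Finset.prod_congr rfl fun j hj => ?_
    rcases (Finset.ne_of_mem_erase hj).lt_or_gt with hlt | hlt
    · rw [if_neg hlt.not_gt, one_mul, abs_of_pos (inv_pos.2 (sub_pos.2 (hv hlt)))]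
    · rw [if_pos hlt, neg_one_mul, abs_of_neg (inv_lt_zero.2 (sub_neg.2 (hv hlt)))]
  have hIoi : (Finset.univ.erase i).filter (i < ·) = Finset.Ioi i := by
    ext j
    simpa using fun h : i < j => h.ne'
  rw [Lagrange.nodalWeight, Finset.abs_prod, habs, Finset.prod_mul_distrib, Finset.prod_ite,
    Finset.prod_const, Finset.prod_const_one, mul_one, hIoi, Fin.card_Ioi, ← mul_assoc, ← pow_add,
    show (i : ℕ) + (n + 1 - 1 - i) = n by lia]

variable {l α : ℝ}

theorem exists_baryWeight_eq_mul_nodalWeight (hl : 0 < l) (hα : -1 / 2 < α) (n : ℕ) :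
    ∃ η ≠ 0, ∀ i, baryWeight l α n i =
      η * Lagrange.nodalWeight Finset.univ (node l α n) i := by
  obtain ⟨c, hc, hc_eq⟩ := exists_node_mul_sub_mul_christoffel_eq hl hα n
  set k : ℝ := (4 : ℝ) ^ α * l ^ (-2 * (1 + α)) with hk
  have hk0 : 0 < k := by positivity
  refine ⟨2 * √(k * c) * (-1) ^ n, ?_, fun i => ?_⟩
  · have := Real.sqrt_pos.2 (mul_pos hk0 hc)
    exact mul_ne_zero (by positivity) (pow_ne_zero _ (by norm_num))
  · have hsq : k * (l - node l α n i) * node l α n i * christoffel l α n i =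
        (k * c) * Lagrange.nodalWeight Finset.univ (node l α n) i ^ 2 := by
      linear_combination k * hc_eq i
    rw [baryWeight, ← hk, hsq, Real.sqrt_mul (by positivity), Real.sqrt_sq_eq_abs]
    linear_combination 2 * √(k * c) *
      neg_one_pow_mul_abs_nodalWeight (node_strictMono hl hα n) i

theorem baryLagrange_eq_eval_basis (hl : 0 < l) (hα : -1 / 2 < α) (n : ℕ) (k : Fin (n + 1))
    {x : ℝ} (hx : ∀ i, x ≠ node l α n i) :
    baryLagrange l α n k x = (Lagrange.basis Finset.univ (node l α n) k).eval x := by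
  obtain ⟨η, hη, hweight⟩ := exists_baryWeight_eq_mul_nodalWeight hl hα n
  have hx' (i) (_ : i ∈ Finset.univ) : x ≠ node l α n i := hx i
  have hone : (Lagrange.nodal Finset.univ (node l α n)).eval x *
      ∑ i, Lagrange.nodalWeight Finset.univ (node l α n) i * (x - node l α n i)⁻¹ = 1 := by
    simpa only [Pi.one_apply, mul_one, eval_one, Finset.univ_nonempty,
      Lagrange.interpolate_one (node_strictMono hl hα n).injective.injOn] using
      (Lagrange.eval_interpolate_not_at_node 1 hx').symm
  have hterm (j) : baryWeight l α n j / (x - node l α n j) =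
      η * (Lagrange.nodalWeight Finset.univ (node l α n) j * (x - node l α n j)⁻¹) := by
    rw [hweight, div_eq_mul_inv, mul_assoc]
  simp only [baryLagrange, hterm, ← Finset.mul_sum]
  rw [mul_div_mul_left _ _ hη, div_eq_iff (right_ne_zero_of_mul_eq_one hone),
    Lagrange.eval_basis_not_at_node (Finset.mem_univ k) (hx k), mul_right_comm, hone, one_mul]

theorem integMatrixOne_eq_integral_basis (hl : 0 < l) (hα : -1 / 2 < α) (n : ℕ)
    (i k : Fin (n + 1)) :
    integMatrixOne l α n i k =
      ∫ x in (0 : ℝ)..(node l α n i), (Lagrange.basis Finset.univ (node l α n) k).eval x := by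
  refine intervalIntegral.integral_congr_ae ?_
  have h : ∀ᵐ x ∂(MeasureTheory.volume : MeasureTheory.Measure ℝ), x ∉ range (node l α n) :=
    MeasureTheory.measure_eq_zero_iff_ae_notMem.1 ((finite_range _).measure_zero _)
  filter_upwards [h] with x hx _
  exact baryLagrange_eq_eval_basis hl hα n k fun i hi => hx ⟨i, hi.symm⟩

end Barycentric

section TruncationError

variable {l α : ℝ}

/-- A bound on `[0, l]` for the monic polynomial with zeros at the `N + 1` shifted
Gegenbauer-Gauss nodes. It carries the factor `D^{(α)}`, so that it is the common factor of
`D^{(α)} ε₁` and `D^{(α)} ε₂`. -/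
noncomputable def nodalBound (l α : ℝ) (N : ℕ) : ℝ :=
  constD α * ((4 : ℝ)⁻¹ ^ N * l ^ (N + 1) / Real.Gamma (N + α + 1) * gegenbauerBound α N)

theorem inv_leadingCoeff_shiftedGegenbauer_mul_Gamma (hl : 0 < l) (hα : -1 / 2 < α) (N : ℕ) :
    ((shiftedGegenbauer l α (N + 1)).leadingCoeff * Real.Gamma (N + 1 + 2 * α))⁻¹ =
      constD α * ((4 : ℝ)⁻¹ ^ N * l ^ (N + 1) / Real.Gamma (N + α + 1)) := by
  have hlead := coeff_gegenbauer_succ_mul_Gamma hα N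
  have := Real.Gamma_pos_of_pos (s := 1 + 2 * α) (by linarith)
  have := Real.Gamma_pos_of_pos (s := N + 1 + α) (by linarith [N.cast_nonneg (α := ℝ)])
  have hpow : (4 : ℝ)⁻¹ ^ N * l ^ (N + 1) * (2 / l) ^ (N + 1) * 2 ^ N = 2 := by
    rw [mul_assoc (_ ^ N), ← mul_pow, mul_div_cancel₀ _ hl.ne', pow_succ, mul_right_comm,
      ← mul_assoc, ← mul_pow, ← mul_pow]
    norm_num
  refine inv_eq_of_mul_eq_one_right ?_
  rw [leadingCoeff_shiftedGegenbauer_succ hl hα, constD, add_right_comm (N : ℝ) α]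
  set c := (gegenbauer α (N + 1)).coeff (N + 1)
  calc _ = 4⁻¹ ^ N * l ^ (N + 1) * (2 / l) ^ (N + 1) *
        (c * (Real.Gamma (1 + α) * Real.Gamma (N + 1 + 2 * α))) /
          (2 * Real.Gamma (1 + 2 * α) * Real.Gamma (N + 1 + α)) := by ring
    _ = 1 := by
      rw [hlead, div_eq_one_iff_eq (by positivity)]
      linear_combination Real.Gamma (N + 1 + α) * Real.Gamma (1 + 2 * α) * hpow

theorem abs_eval_nodal_node_le (hl : 0 < l) (hα : -1 / 2 < α) (N : ℕ) {x : ℝ}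
    (hx : x ∈ Icc 0 l) :
    |(Lagrange.nodal Finset.univ (node l α N)).eval x| ≤ nodalBound l α N := by
  have hx1 : |2 / l * x - 1| ≤ 1 := by
    have h0 : 0 ≤ 2 / l * x := mul_nonneg (by positivity) hx.1
    have h2 : 2 / l * x ≤ 2 / l * l := mul_le_mul_of_nonneg_left hx.2 (by positivity)
    rw [div_mul_cancel₀ _ hl.ne'] at h2
    exact abs_le.2 ⟨by linarith, by linarith⟩
  have hlead := leadingCoeff_shiftedGegenbauer_succ_pos hl hα N
  have hΓ := Real.Gamma_pos_of_pos (natCast_add_one_add_two_mul_pos hα N)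
  have hbound := abs_eval_gegenbauer_mul_Gamma_le hα N hx1
  rw [← eval_shiftedGegenbauer, shiftedGegenbauer_succ_eq_C_mul_nodal hl hα, eval_mul, eval_C,
    abs_mul, abs_of_pos hlead, mul_right_comm] at hbound
  rw [nodalBound, ← mul_assoc, ← inv_leadingCoeff_shiftedGegenbauer_mul_Gamma hl hα]
  exact (le_inv_mul_iff₀ (mul_pos hlead hΓ)).2 hbound

theorem constD_mul_eps1 (l α : ℝ) (N : ℕ) (B t : ℝ) :
    constD α * eps1 α l N B t = B / (N + 1).factorial * nodalBound l α N * t := by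
  rw [nodalBound, eps1, ← gegenbauerBound]
  ring

theorem eps2_eq_eps1 (hα : -1 / 2 < α) (N : ℕ) (A m y : ℝ) :
    eps2 α l N A m y = eps1 α l N (2 ^ (N + 1) * (A * m)) y := by
  have hΓ := Real.Gamma_pos_of_pos (natCast_add_one_add_two_mul_pos hα N)
  have hpow : (2 : ℝ) ^ (1 - (N : ℤ)) = (4 : ℝ)⁻¹ ^ N * 2 ^ (N + 1) := by
    rw [zpow_sub₀ two_ne_zero, zpow_one, zpow_natCast, inv_pow,
      show (4 : ℝ) ^ N = 2 ^ N * 2 ^ N by rw [← mul_pow]; norm_num, pow_succ]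
    field_simp
  rw [add_right_comm] at hΓ
  rw [eps2, eps1, hpow, add_comm (1 : ℝ), add_right_comm (N : ℝ) 1 α]
  split_ifs with hα0 heven
  · ring
  · obtain ⟨m, rfl⟩ := heven
    have hchoose : 0 < Ring.choose (((m + m : ℕ) : ℝ) / 2 + α) ((m + m) / 2) := by
      rw [← two_mul, Nat.mul_div_cancel_left m two_pos, Nat.cast_mul, Nat.cast_two,
        mul_div_cancel_left₀ _ two_ne_zero, add_comm]
      exact choose_add_natCast_pos (by linarith) m
    rw [abs_of_neg (not_le.1 hα0), abs_of_pos hchoose]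
    field_simp
  · field_simp

theorem nodalBound_nonneg (hl : 0 < l) (hα : -1 / 2 < α) (N : ℕ) : 0 ≤ nodalBound l α N :=
  (abs_nonneg _).trans (abs_eval_nodal_node_le hl hα N (left_mem_Icc.2 hl.le))

theorem constD_mul_eps1_mono (hl : 0 < l) (hα : -1 / 2 < α) (N : ℕ) {B B' t : ℝ}
    (hB : B ≤ B') (ht : 0 ≤ t) : constD α * eps1 α l N B t ≤ constD α * eps1 α l N B' t := by
  have := nodalBound_nonneg hl hα N
  rw [constD_mul_eps1, constD_mul_eps1]
  gcongr

theorem constD_mul_eps2_mono (hl : 0 < l) (hα : -1 / 2 < α) (N : ℕ) {A m m' y : ℝ}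
    (hA : 0 ≤ A) (hm : m ≤ m') (hy : 0 ≤ y) :
    constD α * eps2 α l N A m y ≤ constD α * eps2 α l N A m' y := by
  rw [eps2_eq_eps1 hα, eps2_eq_eps1 hα]
  exact constD_mul_eps1_mono hl hα N (by gcongr) hy

/-- The error at the node `x_i` of the `q`-th order integration matrix applied to `g`, as an
approximation of the `q`-fold iterated integral. -/
noncomputable def integError (l α : ℝ) (N q : ℕ) (g : ℝ → ℝ) (i : Fin (N + 1)) : ℝ :=
  iterInt q g (node l α N i) - ∑ k, integMatrix l α N q i k * g (node l α N k)

theorem totalError_eq_add (L tf α : ℝ) (Ny Nt : ℕ) (f : ℝ → ℝ) (φ u : ℝ → ℝ → ℝ)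
    (i : Fin (Ny + 1)) (j : Fin (Nt + 1)) :
    totalError L tf α Ny Nt f φ u i j =
      integError L α Ny 2 (fun y => φ y (node tf α Nt j)) i +
        integError tf α Nt 1 (psi φ u (node L α Ny i)) j := by
  simp only [totalError, integralResidual, discreteResidual, integError]
  ring

theorem exists_abs_integError_one_le (hl : 0 < l) (hα : -1 / 2 < α) {N : ℕ} {g : ℝ → ℝ}
    (hg : ∀ k ≤ N, DifferentiableOn ℝ (iteratedDerivWithin k g (Icc 0 l)) (Icc 0 l))
    (i : Fin (N + 1)) :
    ∃ ζ ∈ Ioo 0 l, |integError l α N 1 g i| ≤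
      constD α * eps1 α l N |iteratedDerivWithin (N + 1) g (Icc 0 l) ζ| (node l α N i) := by
  have hcard : (Finset.univ : Finset (Fin (N + 1))).card = N + 1 := Finset.card_fin _
  obtain ⟨ζ, hζ, h⟩ := exists_abs_integral_sub_sum_le (s := Finset.univ) (v := node l α N)
    (by simpa only [hcard, Nat.lt_succ_iff] using hg) Finset.univ_nonempty
    (node_strictMono hl hα N).injective.injOn
    (fun k _ => Ioo_subset_Icc_self (node_mem_Ioo hl hα N k)) hl
    (fun x hx => abs_eval_nodal_node_le hl hα N hx) (Ioo_subset_Icc_self (node_mem_Ioo hl hα N i))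
  refine ⟨ζ, hζ, ?_⟩
  rw [constD_mul_eps1]
  simpa only [integError, iterInt, integMatrix, tsub_self, pow_zero, Nat.factorial_zero,
    Nat.cast_one, div_one, one_mul, integMatrixOne_eq_integral_basis hl hα, hcard, sub_zero]
    using h

theorem integral_integral_eq_integral_sub_mul {g : ℝ → ℝ} (hg : Continuous g) (y : ℝ) :
    ∫ s in (0 : ℝ)..y, ∫ r in (0 : ℝ)..s, g r = ∫ s in (0 : ℝ)..y, (y - s) * g s := by
  have h := intervalIntegral.integral_mul_deriv_eq_deriv_mul (a := 0) (b := y)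
    (u := fun s => y - s) (u' := fun _ => -1) (fun s _ => (hasDerivAt_id s).const_sub y)
    (fun s _ => (hg.integral_hasStrictDerivAt 0 s).hasDerivAt)
    (continuous_const.intervalIntegrable _ _) (hg.intervalIntegrable _ _)
  rw [h]
  simp

theorem iterInt_two_eq_integral_sub_mul {g : ℝ → ℝ} {y : ℝ} (hy : 0 ≤ y)
    (hg : ContinuousOn g (Icc 0 y)) :
    iterInt 2 g y = ∫ s in (0 : ℝ)..y, (y - s) * g s := by
  have hext : EqOn g (IccExtend hy ((Icc 0 y).domRestrict g)) (Icc 0 y) := fun s hs => by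
    rw [IccExtend_of_mem hy _ hs, domRestrict_apply]
  have hcont : Continuous (IccExtend hy ((Icc 0 y).domRestrict g)) :=
    (continuousOn_iff_continuous_domRestrict.1 hg).Icc_extend'
  have hsub {s : ℝ} (hs : s ∈ uIcc 0 y) : uIcc 0 s ⊆ Icc 0 y :=
    (uIcc_subset_uIcc_left hs).trans (uIcc_of_le hy).subset
  calc ∫ s in (0 : ℝ)..y, ∫ r in (0 : ℝ)..s, g r
      = ∫ s in (0 : ℝ)..y, ∫ r in (0 : ℝ)..s, IccExtend hy ((Icc 0 y).domRestrict g) r :=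
        intervalIntegral.integral_congr fun s hs =>
          intervalIntegral.integral_congr fun r hr => hext (hsub hs hr)
    _ = ∫ s in (0 : ℝ)..y, (y - s) * IccExtend hy ((Icc 0 y).domRestrict g) s :=
        integral_integral_eq_integral_sub_mul hcont y
    _ = _ := intervalIntegral.integral_congr fun s hs =>
        congrArg ((y - s) * ·) (hext (hsub right_mem_uIcc hs)).symm

theorem integError_two_eq_integError_one (hl : 0 < l) (hα : -1 / 2 < α) {N : ℕ} {g : ℝ → ℝ}
    (hg : ContinuousOn g (Icc 0 l)) (i : Fin (N + 1)) :
    integError l α N 2 g i = integError l α N 1 (fun s => (node l α N i - s) * g s) i := by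
  have hmem := node_mem_Ioo hl hα N i
  rw [integError, iterInt_two_eq_integral_sub_mul hmem.1.le
    (hg.mono (Icc_subset_Icc_right hmem.2.le))]
  simp only [integError, iterInt, integMatrix, Nat.add_one_sub_one, tsub_self, pow_zero, pow_one,
    Nat.factorial_zero, Nat.factorial_one, Nat.cast_one, div_one, one_mul]
  simp only [mul_left_comm, mul_assoc]

section ConstSubMul

variable {S : Set ℝ} {g : ℝ → ℝ} {x : ℝ}

theorem hasDerivWithinAt_const_sub_mul_iteratedDerivWithin {n : ℕ}
    (hg : ∀ k ≤ n, DifferentiableOn ℝ (iteratedDerivWithin k g S) S) (y : ℝ) (hx : x ∈ S) :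
    HasDerivWithinAt
      (fun s => (y - s) * iteratedDerivWithin n g S s - n * iteratedDerivWithin (n - 1) g S s)
      ((y - x) * iteratedDerivWithin (n + 1) g S x - (n + 1 : ℕ) * iteratedDerivWithin n g S x)
      S x := by
  have hprod := (((hasDerivAt_id x).const_sub y).hasDerivWithinAt (s := S)).mul
    (hasDerivWithinAt_iteratedDerivWithin (hg n le_rfl) hx)
  have hprev : HasDerivWithinAt (fun s => n * iteratedDerivWithin (n - 1) g S s)
      (n * iteratedDerivWithin n g S x) S x := by
    cases n with
    | zero => simpa using hasDerivWithinAt_const x S (0 : ℝ)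
    | succ n => exact (hasDerivWithinAt_iteratedDerivWithin (hg n n.le_succ) hx).const_mul _
  refine (hprod.sub hprev).congr_deriv ?_
  simp only [id]
  push_cast
  ring

theorem iteratedDerivWithin_const_sub_mul (hS : UniqueDiffOn ℝ S) {n : ℕ}
    (hg : ∀ k < n, DifferentiableOn ℝ (iteratedDerivWithin k g S) S) (y : ℝ) :
    EqOn (iteratedDerivWithin n (fun s => (y - s) * g s) S)
      (fun s => (y - s) * iteratedDerivWithin n g S s - n * iteratedDerivWithin (n - 1) g S s)
      S := by
  induction n with
  | zero => intro x _; simp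
  | succ n ih =>
    intro x hx
    have hn := ih fun k hk => hg k (hk.trans n.lt_succ_self)
    rw [iteratedDerivWithin_succ, derivWithin_congr hn (hn hx)]
    exact (hasDerivWithinAt_const_sub_mul_iteratedDerivWithin
      (fun k hk => hg k (Nat.lt_succ_of_le hk)) y hx).derivWithin (hS x hx)

theorem differentiableOn_iteratedDerivWithin_const_sub_mul (hS : UniqueDiffOn ℝ S) {n : ℕ}
    (hg : ∀ k ≤ n, DifferentiableOn ℝ (iteratedDerivWithin k g S) S) (y : ℝ) :
    DifferentiableOn ℝ (iteratedDerivWithin n (fun s => (y - s) * g s) S) S :=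
  DifferentiableOn.congr
    (fun _ hx =>
      (hasDerivWithinAt_const_sub_mul_iteratedDerivWithin hg y hx).differentiableWithinAt)
    (iteratedDerivWithin_const_sub_mul hS (fun k hk => hg k hk.le) y)

end ConstSubMul

theorem exists_abs_integError_two_le (hl : 0 < l) (hα : -1 / 2 < α) {N : ℕ} {g : ℝ → ℝ}
    (hg : ∀ k ≤ N, DifferentiableOn ℝ (iteratedDerivWithin k g (Icc 0 l)) (Icc 0 l))
    {A : ℝ} (hA : ∀ k ≤ N + 1, ∀ x ∈ Icc 0 l, |iteratedDerivWithin k g (Icc 0 l) x| ≤ A)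
    (i : Fin (N + 1)) :
    ∃ ζ ∈ Ioo 0 l, |integError l α N 2 g i| ≤
      constD α * eps2 α l N A (nMax (node l α N i) ζ) (node l α N i) := by
  set y := node l α N i
  have hS := uniqueDiffOn_Icc hl
  have hcont : ContinuousOn g (Icc 0 l) := by
    simpa only [iteratedDerivWithin_zero] using (hg 0 N.zero_le).continuousOn
  obtain ⟨ζ, hζ, h⟩ := exists_abs_integError_one_le hl hα (fun k hk =>
    differentiableOn_iteratedDerivWithin_const_sub_mul hS (fun m hm => hg m (hm.trans hk)) y) i
  have hζ' := Ioo_subset_Icc_self hζ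
  refine ⟨ζ, hζ, ?_⟩
  rw [integError_two_eq_integError_one hl hα hcont, eps2_eq_eps1 hα]
  refine h.trans (constD_mul_eps1_mono hl hα N ?_ (node_mem_Ioo hl hα N i).1.le)
  have hA0 : 0 ≤ A := (abs_nonneg _).trans (hA 0 (Nat.zero_le _) ζ hζ')
  have hpow : (N : ℝ) + 1 + 1 ≤ 2 ^ (N + 1) := by
    exact_mod_cast (Nat.lt_two_pow_self (n := N + 1))
  rw [iteratedDerivWithin_const_sub_mul hS (fun k hk => hg k (Nat.le_of_lt_succ hk)) y hζ']
  calc _ ≤ |y - ζ| * A + (N + 1 : ℕ) * A := by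
        refine (abs_sub _ _).trans ?_
        rw [abs_mul, abs_mul, Nat.abs_cast]
        gcongr
        · exact hA (N + 1) le_rfl ζ hζ'
        · exact hA N N.le_succ ζ hζ'
    _ ≤ A * nMax y ζ + (N + 1 : ℕ) * (A * nMax y ζ) := by
        rw [mul_comm |y - ζ|]
        gcongr
        · exact le_max_right _ _
        · exact le_mul_of_one_le_right hA0 (le_max_left _ _)
    _ = (N + 1 + 1) * (A * nMax y ζ) := by push_cast; ring
    _ ≤ 2 ^ (N + 1) * (A * nMax y ζ) := by
        have : 0 ≤ A * nMax y ζ := mul_nonneg hA0 (zero_le_one.trans (le_max_left _ _))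
        gcongr

end TruncationError

end BSGPM

theorem mainTheorem6_general
    (L tf α : ℝ) (hL : 0 < L) (htf : 0 < tf) (hα : -1 / 2 < α) (Ny Nt : ℕ)
    (f : ℝ → ℝ) (φ u : ℝ → ℝ → ℝ)
    (hψ : ∀ i, ∀ k ≤ Nt, DifferentiableOn ℝ
      (iteratedDerivWithin k (BSGPM.psi φ u (BSGPM.node L α Ny i)) (Icc 0 tf)) (Icc 0 tf))
    (hφ : ∀ j, ∀ k ≤ Ny, DifferentiableOn ℝ
      (iteratedDerivWithin k (fun y => φ y (BSGPM.node tf α Nt j)) (Icc 0 L)) (Icc 0 L))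
    (A : ℝ)
    (hφA : ∀ j, ∀ k ≤ Ny + 1, ∀ y ∈ Icc 0 L,
      |iteratedDerivWithin k (fun y => φ y (BSGPM.node tf α Nt j)) (Icc 0 L) y| ≤ A) :
    ∃ (ζy : Fin (Ny + 1) → ℝ) (ζt : Fin (Nt + 1) → ℝ),
      (∀ i, ζy i ∈ Ioo 0 L) ∧ (∀ j, ζt j ∈ Ioo 0 tf) ∧
      ∀ B : Fin (Nt + 1) → ℝ,
        (∀ j i, |iteratedDerivWithin (Nt + 1) (BSGPM.psi φ u (BSGPM.node L α Ny i)) (Icc 0 tf)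
          (ζt j)| ≤ B j) →
        ∀ i j, |BSGPM.totalError L tf α Ny Nt f φ u i j| ≤
          BSGPM.constD α *
            (BSGPM.eps1 α tf Nt (B j) (BSGPM.node tf α Nt j) +
              BSGPM.eps2 α L Ny A
                (BSGPM.nMax (BSGPM.node L α Ny i) (ζy i)) (BSGPM.node L α Ny i)) := by
  choose ζy hζy hEy using fun i j =>
    BSGPM.exists_abs_integError_two_le hL hα (hφ j) (hφA j) i
  choose ζt hζt hEt using fun i j => BSGPM.exists_abs_integError_one_le htf hα (hψ i) j
  choose jmax hjmax using fun i =>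
    Finite.exists_max fun j => BSGPM.nMax (BSGPM.node L α Ny i) (ζy i j)
  choose imax himax using fun j => Finite.exists_max fun i =>
    |BSGPM.integError tf α Nt 1 (BSGPM.psi φ u (BSGPM.node L α Ny i)) j|
  refine ⟨fun i => ζy i (jmax i), fun j => ζt (imax j) j, fun i => hζy i _, fun j => hζt _ j,
    fun B hB i j => ?_⟩
  have hA : 0 ≤ A := (abs_nonneg _).trans (hφA j 0 (Nat.zero_le _) 0 (left_mem_Icc.2 hL.le))
  have hy := (hEy i j).trans (BSGPM.constD_mul_eps2_mono hL hα Ny hA (hjmax i j)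
    (BSGPM.node_mem_Ioo hL hα Ny i).1.le)
  have ht := ((himax j i).trans (hEt (imax j) j)).trans (BSGPM.constD_mul_eps1_mono htf hα Nt
    (hB j (imax j)) (BSGPM.node_mem_Ioo htf hα Nt j).1.le)
  rw [BSGPM.totalError_eq_add, mul_add, add_comm (BSGPM.constD α * _)]
  exact (abs_add_le _ _).trans (add_le_add hy ht)

theorem mainTheorem6
    (L tf α : ℝ) (hL : 0 < L) (htf : 0 < tf) (hα : -1 / 2 < α)
    (Ny Nt : ℕ) (hNy : 1 ≤ Ny) (hNt : 1 ≤ Nt)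
    (f : ℝ → ℝ) (φ u : ℝ → ℝ → ℝ)
    -- `ψ(y, ·)` is of class `C^{Nt+1}` on `[0, tf]` for every `y ∈ [0, L]`
    (hψ : ∀ y ∈ Set.Icc 0 L,
      ContDiffOn ℝ ((Nt + 1 : ℕ) : ℕ∞) (fun t => BSGPM.psi φ u y t) (Set.Icc 0 tf))
    -- the `y`-derivatives of `φ` up to order `Ny + 1` exist on `[0, L] × [0, tf]` ...
    (hφ : ∀ t ∈ Set.Icc 0 tf, ∀ k ≤ Ny,
      DifferentiableOn ℝ (iteratedDerivWithin k (fun y => φ y t) (Set.Icc 0 L)) (Set.Icc 0 L))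
    -- ... and are bounded by `A`
    (A : ℝ) (hA : 0 < A)
    (hφA : ∀ k ≤ Ny + 1, ∀ y ∈ Set.Icc 0 L, ∀ t ∈ Set.Icc 0 tf,
      |iteratedDerivWithin k (fun s => φ s t) (Set.Icc 0 L) y| ≤ A) :
    ∃ (ζy : Fin (Ny + 1) → ℝ) (ζt : Fin (Nt + 1) → ℝ),
      (∀ i, ζy i ∈ Set.Ioo 0 L) ∧ (∀ j, ζt j ∈ Set.Ioo 0 tf) ∧
      ∀ B : Fin (Nt + 1) → ℝ, (∀ j, 0 < B j) →
        (∀ j, ∀ y ∈ Set.Icc 0 L,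
          |iteratedDerivWithin (Nt + 1) (fun t => BSGPM.psi φ u y t) (Set.Icc 0 tf) (ζt j)|
            ≤ B j) →
        ∀ (i : Fin (Ny + 1)) (j : Fin (Nt + 1)),
          |BSGPM.totalError L tf α Ny Nt f φ u i j| ≤
            BSGPM.constD α *
              (BSGPM.eps1 α tf Nt (B j) (BSGPM.node tf α Nt j) +
                BSGPM.eps2 α L Ny A
                  (BSGPM.nMax (BSGPM.node L α Ny i) (ζy i)) (BSGPM.node L α Ny i)) := by
  have hy i := Ioo_subset_Icc_self (BSGPM.node_mem_Ioo hL hα Ny i)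
  have ht j := Ioo_subset_Icc_self (BSGPM.node_mem_Ioo htf hα Nt j)
  obtain ⟨ζy, ζt, hζy, hζt, h⟩ := mainTheorem6_general L tf α hL htf hα Ny Nt f φ u
    (fun i k hk => (hψ _ (hy i)).differentiableOn_iteratedDerivWithin
      (by exact_mod_cast Nat.lt_succ_of_le hk) (uniqueDiffOn_Icc htf))
    (fun j => hφ _ (ht j)) A (fun j k hk y hy => hφA k hk y hy _ (ht j))
  exact ⟨ζy, ζt, hζy, hζt, fun B _ hB => h B fun j i => hB j _ (hy i)⟩
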